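/- **Calculus.** Fix a family of algebraic data types $T$, each with finitely many constructors $D$, whose fields have basic types. Basic types are $B ::= \mathsf{Int}\mid\mathsf{Bool}\mid T$; simple types are $\sigma ::= B\mid\sigma\to\sigma$. Terms are $$p,e ::= x\mid c\mid\lambda x.e\mid e\,e\mid \mathsf{case}\ x=e\ \mathsf{of}\ \{D_i\,\bar y_i\to e_i\}\mid\mathsf{let\ rec}\ x:\tau=e\ \mathsf{in}\ p\mid\mathsf{reflect}\ f:\tau=e\ \mathsf{in}\ p,$$ with case analysis on $\mathsf{Bool}$ included. In $\mathsf{let\ rec}$ and $\mathsf{reflect}$ the variable is bound in $e$ and $p$, not in $\tau$. Constants are integers, $\mathsf{True},\mathsf{False},\lnot,\land,\lor,<,\le,+,-,\times$, equality $=_\sigma$, the structural size of data values, the constructors $D$, and $\mathsf{fix}$. Refinement types are $$\tau ::= \{v:B^{\ell}\mid r\}\mid x:\tau\to\tau,$$ where $r$ is a term and the label $\ell$ is either the termination mark $\Downarrow$ or absent. $\lfloor\tau\rfloor$ is the simple type got by erasing refinements and labels. $\vdash e:\sigma$ is the standard simple typing of closed terms, in which equality is available only at basic types (function equality occurs in refinements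 only). A type $\tau$ *may diverge* if its final result carries no $\Downarrow$. $B$ abbreviates $\{v:B\mid\mathsf{True}\}$. **Evaluation.** $\hookrightarrow$ is call-by-name small-step reduction. Values are constants, abstractions, constructors applied to values, and partially applied primitives. The rules are: $\beta$; primitives applied to evaluated arguments; left-to-right evaluation of constructor arguments; $\mathsf{case}\ x=D_j\,\bar e\ \mathsf{of}\{\dots\}\hookrightarrow e_j[x\mapsto D_j\,\bar e][\bar y_j\mapsto\bar e]$, the scrutinee being evaluated only until its head constructor appears; $\mathsf{fix}\,f\hookrightarrow f\,(\mathsf{fix}\,f)$; $(\mathsf{let\ rec}\ x:\tau=e\ \mathsf{in}\ p)\hookrightarrow p[x\mapsto\mathsf{fix}(\lambda x.e)]$; $(\mathsf{reflect}\ f:\tau=e\ \mathsf{in}\ p)\hookrightarrow(\mathsf{let\ rec}\ f:\tau=e\ \mathsf{in}\ p)$. Equality at a basic type compares values. Equality at a function type $\sigma\to\sigma'$ reduces $f=g$ to $\mathsf{True}$ if $f\,v\approx g\,v$ for every closed value $v$ with $\vdash v:\sigma$, and to $\mathsf{False}$ otherwise; here $\approx$ is the equivalence closure of reduction without the rule for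 function equality. **Denotations.** For closed types, with $w$ ranging over values: - $\llbracket\{v:B\mid r\}\rrbracket=\{e\mid\ \vdash e:B,\ \text{and } e\hookrightarrow^* w \text{ implies } r[v\mapsto w]\hookrightarrow^*\mathsf{True}\}$; - $\llbracket\{v:B^{\Downarrow}\mid r\}\rrbracket=\llbracket\{v:B\mid r\}\rrbracket\cap\{e\mid\exists w.\ e\hookrightarrow^* w\}$; - $\llbracket x:\tau_x\to\tau\rrbracket=\{e\mid\ \vdash e:\lfloor\tau_x\to\tau\rfloor,\ \forall a\in\llbracket\tau_x\rrbracket.\ e\,a\in\llbracket\tau[x\mapsto a]\rrbracket\}$. For an environment $\Gamma$ (a sequence of bindings $x:\tau$), $\llbracket\Gamma\rrbracket$ is the set of substitutions $\theta$ of terms for the variables of $\Gamma$ such that $\theta(x)\in\llbracket\theta(\tau)\rrbracket$ for every $x:\tau$ in $\Gamma$. A type may mention the variable it is assigned to, as reflected types do. **Subtyping.** $\Gamma\vdash\{v:B^{\ell}\mid r\}\preceq\{v:B^{\ell'}\mid r'\}$ if $\llbracket\theta\{v:B^\ell\mid r\}\rrbracket\subseteq\llbracket\theta\{v:B^{\ell'}\mid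 r'\}\rrbracket$ for all $\theta\in\llbracket\Gamma\rrbracket$. Function types are contravariant in the argument $\tau_x$ and covariant in the result, the results being compared under $x:\tau_x'$ for the smaller argument type $\tau_x'$. **Typing.** $\Gamma\vdash p:\tau$ is generated by: - *Variables*: $\Gamma\vdash x:\tau$ for $x:\tau\in\Gamma$. - *Constants*: a literal $c$ has type $\{v:B^\Downarrow\mid v=c\}$. For each label $\ell$, a first-order primitive or constructor $c$ has type $x_1:B_1^\ell\to\dots\to x_k:B_k^\ell\to\{v:B^\ell\mid v=c\,x_1\cdots x_k\}$. - *Fix*: $\Gamma\vdash\mathsf{fix}:(\tau\to\tau)\to\tau$ if $\tau$ may diverge. - *Subsumption*, along $\preceq$. - *Exact*: from $\Gamma\vdash e:\{v:B^\ell\mid r\}$ infer $\Gamma\vdash e:\{v:B^\ell\mid r\land v=e\}$. - *Abstraction*: from $\Gamma,x:\tau_x\vdash e:\tau$ infer $\Gamma\vdash\lambda x.e:(x:\tau_x\to\tau)$. - *Application*: from $\Gamma\vdash e_1:(x:\tau_x\to\tau)$ and $\Gamma\vdash e_2:\tau_x$ infer $\Gamma\vdash e_1\,e_2:\tau[x\mapsto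 e_2]$. - *Case*: if $\Gamma\vdash e:\{v:T^\ell\mid r\}$, $\Gamma\vdash\tau$, and $\Gamma,\bar y_i:\bar B_i^{\ell},x:\{v:T^\ell\mid r\land v=D_i\,\bar y_i\}\vdash e_i:\tau$ for every $i$, then $\Gamma\vdash\mathsf{case}\ x=e\ \mathsf{of}\{D_i\,\bar y_i\to e_i\}:\tau$, provided that $\ell={\Downarrow}$ or $\tau$ may diverge. Similarly for $\mathsf{Bool}$, with $v=\mathsf{True}$ and $v=\mathsf{False}$. - *Let*: if the definition $x=e$ checks at $\tau_x$ in $\Gamma$, $\Gamma,x:\tau_x\vdash p:\tau$ and $\Gamma\vdash\tau$, then $\Gamma\vdash\mathsf{let\ rec}\ x:\tau_x=e\ \mathsf{in}\ p:\tau$. - *Reflect*: if the definition $f=e$ checks at $\tau'=\mathrm{Refl}(\tau_f,e)$ in $\Gamma$, $\Gamma,f:\tau'\vdash p:\tau$ and $\Gamma\vdash\tau$, then $\Gamma\vdash\mathsf{reflect}\ f:\tau_f=e\ \mathsf{in}\ p:\tau$. Here $\mathrm{Refl}$ is the partial function with $\mathrm{Refl}(\{v:B^\ell\mid r\},e)=\{v:B^\ell\mid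 r\land v=e\}$ and $\mathrm{Refl}(x:\tau_x\to\tau,\lambda x.e)=x:\tau_x\to\mathrm{Refl}(\tau,e)$. A definition $x=e$ *checks* at $\tau$ in $\Gamma$ in one of three ways: 1. $\tau$ may diverge and $\Gamma,x:\tau\vdash e:\tau$; 2. (not recursive) $x$ occurs in neither $e$ nor $\tau$, and $\Gamma\vdash e:\tau$; 3. (termination check) $\tau$ has parameters $y_0:\tau_0,\dots,y_k:\tau_k$ (among possibly more) with $\tau_k=\{v:B^{\Downarrow}\mid s\}$ and $x$ not in $\tau_0,\dots,\tau_k$; there is a metric $\Gamma\vdash m:(y_0:\tau_0\to\dots\to y_k:\tau_k\to\mathsf{Int}^\Downarrow)$ not mentioning $x$; and $\Gamma,n:\mathsf{Int}^{\Downarrow},x:\tau_{<n}\vdash e:\tau_{=n}$ for fresh $n$. Here $\tau_{<n}$ is $\tau$ with $s$ strengthened to $s\land(0\le m\,\bar y\,v\land m\,\bar y\,v<n)$, and $\tau_{=n}$ is $\tau$ with $s$ strengthened to $s\land m\,\bar y\,v=n$. *Well-formedness* $\Gamma\vdash\tau$: every refinement $r$ in $\tau$ has type $\mathsf{Bool}^{\Downarrow}$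 under the bindings in scope and $v:B^{\Downarrow}$. In checking refinements, and only there, equality at a function type $\sigma\to\sigma'$ also has the types $x:\tau_1\to y:\tau_2\to\{v:\mathsf{Bool}^{\Downarrow}\mid v=(x=y)\}$, for $\lfloor\tau_1\rfloor=\lfloor\tau_2\rfloor=\sigma\to\sigma'$. **Theorem (Denotations).** If $\Gamma\vdash p:\tau$, then for every $\theta\in\llbracket\Gamma\rrbracket$, $\theta(p)\in\llbracket\theta(\tau)\rrbracket$. -/

import Mathlib

namespace Refl

/-! ## Types without refinements -/

/-- Basic types: integers, booleans and the data types, whose names are drawn from `T`. -/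
inductive Base (T : Type) : Type
  | int : Base T
  | bool : Base T
  | data : T → Base T

/-- A family of (possibly recursive) first-order algebraic data types: each data type has finitely
many constructors, each constructor a list of fields of basic type. -/
structure DataSig : Type 1 where
  T : Type
  ncon : T → ℕ
  fields : (t : T) → Fin (ncon t) → List (Base T)

/-- Simple (unrefined) types. -/
inductive STy (S : DataSig) : Type
  | base : Base S.T → STy S
  | fn : STy S → STy S → STy S

/-- `σ₁ → ⋯ → σₖ → σ`. -/
def STy.arrows {S : DataSig} (l : List (STy S)) (σ : STy S) : STy S := l.foldr STy.fn σ

/-- Termination labels: `tot` is the mark `⇓`, `any` is its absence. -/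
inductive Label : Type
  | any : Label
  | tot : Label

/-! ## Constants -/

inductive BinOp : Type
  | and | or | lt | le | add | sub | mul

/-- The type of both arguments of an operator. -/
def BinOp.dom {T : Type} : BinOp → Base T
  | .and => .bool
  | .or => .bool
  | .lt => .int
  | .le => .int
  | .add => .int
  | .sub => .int
  | .mul => .int

/-- The type of the result of an operator. -/
def BinOp.cod {T : Type} : BinOp → Base T
  | .and => .bool
  | .or => .bool
  | .lt => .bool
  | .le => .bool
  | .add => .int
  | .sub => .int
  | .mul => .int

/-- Constants. Equality is a family indexed by the simple type of the compared terms; data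
constructors are constants; `size t` is the structural size of the values of the data type `t`. -/
inductive Cst (S : DataSig) : Type
  | int : ℤ → Cst S
  | bool : Bool → Cst S
  | not : Cst S
  | bin : BinOp → Cst S
  | eq : STy S → Cst S
  | size : S.T → Cst S
  | con : (t : S.T) → Fin (S.ncon t) → Cst S
  | fix : Cst S

/-- The primitive operation of a binary operator on literals. -/
def BinOp.eval {S : DataSig} : BinOp → Cst S → Cst S → Option (Cst S)
  | .and, .bool a, .bool b => some (.bool (a && b))
  | .or, .bool a, .bool b => some (.bool (a || b))
  | .lt, .int a, .int b => some (.bool (decide (a < b)))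
  | .le, .int a, .int b => some (.bool (decide (a ≤ b)))
  | .add, .int a, .int b => some (.int (a + b))
  | .sub, .int a, .int b => some (.int (a - b))
  | .mul, .int a, .int b => some (.int (a * b))
  | _, _, _ => none

/-! ## Terms and refinement types, in de Bruijn notation -/

mutual

/-- Terms: expressions, binders and programs in one syntactic class.
* `caseD t e br` is `case x = e of {Dᵢ ȳᵢ → br i}`; in `br i`, index `0` is `x` and index `j + 1` is
  the `j`-th field.
* `caseB e e₁ e₂` is `case x = e of {True → e₁; False → e₂}`; `x` is index `0` of both branches.
* `letE τ b₁ b₂` is `let rec x : τ = b₁ in b₂`, with `x` bound in `b₁` and `b₂` but not in `τ`.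
* `reflect τ e p` is `reflect f : τ = e in p`, with `f` bound in `e` and `p` but not in `τ`. -/
inductive Term (S : DataSig) : Type
  | var : ℕ → Term S
  | cst : Cst S → Term S
  | lam : Term S → Term S
  | app : Term S → Term S → Term S
  | caseD : (t : S.T) → Term S → (Fin (S.ncon t) → Term S) → Term S
  | caseB : Term S → Term S → Term S → Term S
  | letE : RType S → Term S → Term S → Term S
  | reflect : RType S → Term S → Term S → Term S

/-- Refinement types: `base b l r` is `{v : b^l | r}`, where `v` is index `0` of `r`, and
`fn τ₁ τ₂` is the dependent function type `x : τ₁ → τ₂`, where `x` is index `0` of `τ₂`. -/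
inductive RType (S : DataSig) : Type
  | base : Base S.T → Label → Term S → RType S
  | fn : RType S → RType S → RType S

end

variable {S : DataSig}

/-- Number of fields of a constructor. -/
def arity (t : S.T) (i : Fin (S.ncon t)) : ℕ := (S.fields t i).length

/-- Pass a renaming under one binder. -/
def upRen (ρ : ℕ → ℕ) : ℕ → ℕ
  | 0 => 0
  | n + 1 => ρ n + 1

mutual

/-- Renaming of variables. -/
def Term.rename : Term S → (ℕ → ℕ) → Term S
  | .var n, ρ => .var (ρ n)
  | .cst c, _ => .cst c
  | .lam e, ρ => .lam (e.rename (upRen ρ))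
  | .app e₁ e₂, ρ => .app (e₁.rename ρ) (e₂.rename ρ)
  | .caseD t e br, ρ =>
      .caseD t (e.rename ρ) (fun i => (br i).rename (upRen^[arity t i + 1] ρ))
  | .caseB e e₁ e₂, ρ => .caseB (e.rename ρ) (e₁.rename (upRen ρ)) (e₂.rename (upRen ρ))
  | .letE τ b₁ b₂, ρ => .letE (τ.rename ρ) (b₁.rename (upRen ρ)) (b₂.rename (upRen ρ))
  | .reflect τ e p, ρ => .reflect (τ.rename ρ) (e.rename (upRen ρ)) (p.rename (upRen ρ))

/-- Renaming of variables. -/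
def RType.rename : RType S → (ℕ → ℕ) → RType S
  | .base b l r, ρ => .base b l (r.rename (upRen ρ))
  | .fn τ₁ τ₂, ρ => .fn (τ₁.rename ρ) (τ₂.rename (upRen ρ))

end

/-- Weakening by `k` innermost variables. -/
def Term.shift (k : ℕ) (e : Term S) : Term S := e.rename (· + k)

/-- Weakening by `k` innermost variables. -/
def RType.shift (k : ℕ) (τ : RType S) : RType S := τ.rename (· + k)

/-- Pass a substitution under one binder. -/
def upSub (s : ℕ → Term S) : ℕ → Term S
  | 0 => .var 0
  | n + 1 => (s n).shift 1

mutual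

/-- Simultaneous capture-avoiding substitution. -/
def Term.subst : Term S → (ℕ → Term S) → Term S
  | .var n, s => s n
  | .cst c, _ => .cst c
  | .lam e, s => .lam (e.subst (upSub s))
  | .app e₁ e₂, s => .app (e₁.subst s) (e₂.subst s)
  | .caseD t e br, s =>
      .caseD t (e.subst s) (fun i => (br i).subst (upSub^[arity t i + 1] s))
  | .caseB e e₁ e₂, s => .caseB (e.subst s) (e₁.subst (upSub s)) (e₂.subst (upSub s))
  | .letE τ b₁ b₂, s => .letE (τ.subst s) (b₁.subst (upSub s)) (b₂.subst (upSub s))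
  | .reflect τ e p, s => .reflect (τ.subst s) (e.subst (upSub s)) (p.subst (upSub s))

/-- Simultaneous capture-avoiding substitution. -/
def RType.subst : RType S → (ℕ → Term S) → RType S
  | .base b l r, s => .base b l (r.subst (upSub s))
  | .fn τ₁ τ₂, s => .fn (τ₁.subst s) (τ₂.subst (upSub s))

end

/-- A list of terms as a substitution for the innermost variables: index `i` goes to the `i`-th
term of the list, and the variables beyond the list are renumbered. -/
def subOf (θ : List (Term S)) (i : ℕ) : Term S :=
  match θ[i]? with
  | some e => e
  | none => .var (i - θ.length)

/-- `e[x ↦ a]` for the innermost variable `x`. -/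
def Term.inst (e a : Term S) : Term S := e.subst (subOf [a])

/-- `τ[x ↦ a]` for the innermost variable `x`. -/
def RType.inst (τ : RType S) (a : Term S) : RType S := τ.subst (subOf [a])

/-! ## Abbreviations -/

/-- `f e₁ ⋯ eₖ`. -/
def Term.apps (f : Term S) (es : List (Term S)) : Term S := es.foldl Term.app f

def tBool (b : Bool) : Term S := .cst (.bool b)

def tInt (n : ℤ) : Term S := .cst (.int n)

def tBin (o : BinOp) (e₁ e₂ : Term S) : Term S := .app (.app (.cst (.bin o)) e₁) e₂

/-- `e₁ = e₂` at the basic type `b`. -/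
def tEq (b : Base S.T) (e₁ e₂ : Term S) : Term S := .app (.app (.cst (.eq (.base b))) e₁) e₂

/-- `fix (λ x. b)`, for a term `b` with the bound variable `x`. -/
def tFix (b : Term S) : Term S := .app (.cst .fix) (.lam b)

/-- The trivially refined basic type `{v : b^l | True}`. -/
def triv (b : Base S.T) (l : Label) : RType S := .base b l (tBool true)

/-- Erasure of all refinements and labels. -/
def RType.erase : RType S → STy S
  | .base b _ _ => .base b
  | .fn τ₁ τ₂ => .fn τ₁.erase τ₂.erase

/-- The result of the type does not carry the termination mark. -/
def RType.MayDiverge : RType S → Prop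
  | .base _ l _ => l = .any
  | .fn _ τ₂ => τ₂.MayDiverge

/-! ## Simple typing of source terms -/

/-- The simple types of the constants. There is no entry for equality at function types: source
terms contain implementable equalities only, function equality is confined to refinements. -/
inductive CstTy : Cst S → STy S → Prop
  | int (n : ℤ) : CstTy (.int n) (.base .int)
  | bool (b : Bool) : CstTy (.bool b) (.base .bool)
  | not : CstTy .not (.fn (.base .bool) (.base .bool))
  | bin (o : BinOp) : CstTy (.bin o) (.fn (.base o.dom) (.fn (.base o.dom) (.base o.cod)))
  | eq (b : Base S.T) : CstTy (.eq (.base b)) (.fn (.base b) (.fn (.base b) (.base .bool)))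
  | size (t : S.T) : CstTy (.size t) (.fn (.base (.data t)) (.base .int))
  | con (t : S.T) (i : Fin (S.ncon t)) :
      CstTy (.con t i) (STy.arrows ((S.fields t i).map STy.base) (.base (.data t)))
  | fix (σ : STy S) : CstTy .fix (.fn (.fn σ σ) σ)

/-- The typing relation of the simply typed lambda calculus, `Δ ⊢ e : σ`. -/
inductive STyped : List (STy S) → Term S → STy S → Prop
  | var {Δ i σ} : Δ[i]? = some σ → STyped Δ (.var i) σ
  | cst {Δ c σ} : CstTy c σ → STyped Δ (.cst c) σ
  | lam {Δ e σ₁ σ₂} : STyped (σ₁ :: Δ) e σ₂ → STyped Δ (.lam e) (.fn σ₁ σ₂)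
  | app {Δ e₁ e₂ σ₁ σ₂} :
      STyped Δ e₁ (.fn σ₁ σ₂) → STyped Δ e₂ σ₁ → STyped Δ (.app e₁ e₂) σ₂
  | caseD {Δ t e br σ} :
      STyped Δ e (.base (.data t)) →
      (∀ i, STyped (.base (.data t) :: ((S.fields t i).map STy.base ++ Δ)) (br i) σ) →
      STyped Δ (.caseD t e br) σ
  | caseB {Δ e e₁ e₂ σ} :
      STyped Δ e (.base .bool) →
      STyped (.base .bool :: Δ) e₁ σ → STyped (.base .bool :: Δ) e₂ σ →
      STyped Δ (.caseB e e₁ e₂) σ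
  | letE {Δ τ b₁ b₂ σ} :
      STyped (τ.erase :: Δ) b₁ τ.erase → STyped (τ.erase :: Δ) b₂ σ →
      STyped Δ (.letE τ b₁ b₂) σ
  | reflect {Δ τ e p σ} :
      STyped (τ.erase :: Δ) e τ.erase → STyped (τ.erase :: Δ) p σ →
      STyped Δ (.reflect τ e p) σ

/-! ## Operational semantics -/

/-- Constants that evaluate their arguments. -/
def Cst.Strict : Cst S → Prop
  | .not => True
  | .bin _ => True
  | .eq (.base _) => True
  | .size _ => True
  | _ => False

/-- Strict constants with two arguments. -/
def Cst.Strict₂ : Cst S → Prop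
  | .bin _ => True
  | .eq (.base _) => True
  | _ => False

/-- Values: constants, abstractions, constructors applied to values, and partially applied
primitives. -/
inductive Value : Term S → Prop
  | cst (c : Cst S) : Value (.cst c)
  | lam (e : Term S) : Value (.lam e)
  | con (t : S.T) (i : Fin (S.ncon t)) (ws : List (Term S)) :
      ws.length ≤ arity t i → (∀ w ∈ ws, Value w) → Value (Term.apps (.cst (.con t i)) ws)
  | partialPrim (c : Cst S) (w : Term S) : c.Strict₂ → Value w → Value (.app (.cst c) w)
  | partialEq (σ₁ σ₂ : STy S) (f : Term S) : Value (.app (.cst (.eq (.fn σ₁ σ₂))) f)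

/-- Number of constructors in a data value. -/
def Term.dsize : Term S → ℕ
  | .cst (.con _ _) => 1
  | .app e₁ e₂ => e₁.dsize + e₂.dsize
  | _ => 0

/-- `e` is a fully applied constructor of the data type `t`. -/
def IsCon (t : S.T) (e : Term S) : Prop :=
  ∃ (i : Fin (S.ncon t)) (es : List (Term S)),
    es.length = arity t i ∧ e = Term.apps (.cst (.con t i)) es

/-- Call-by-name small-step evaluation, relative to the answers `E σ₁ σ₂ f g b` that equality at the
function type `σ₁ → σ₂` gives. Arguments of primitives are evaluated, arguments of constructors are
evaluated from left to right, and a `case` fires as soon as its scrutinee is a constructor application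
(with arguments that need not be evaluated). -/
inductive StepE (E : STy S → STy S → Term S → Term S → Bool → Prop) : Term S → Term S → Prop
  | beta (e a) : StepE E (.app (.lam e) a) (e.inst a)
  | appL {f f'} (a) : StepE E f f' → StepE E (.app f a) (.app f' a)
  | primArg {c a a'} : c.Strict → StepE E a a' → StepE E (.app (.cst c) a) (.app (.cst c) a')
  | primArg₂ {c w a a'} : c.Strict₂ → Value w → StepE E a a' →
      StepE E (.app (.app (.cst c) w) a) (.app (.app (.cst c) w) a')
  | conArg {t i ws a a'} : ws.length < arity t i → (∀ w ∈ ws, Value w) → StepE E a a' →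
      StepE E (.app (Term.apps (.cst (.con t i)) ws) a) (.app (Term.apps (.cst (.con t i)) ws) a')
  | not (b) : StepE E (.app (.cst .not) (tBool b)) (tBool (!b))
  | bin {o c₁ c₂ c} : BinOp.eval o c₁ c₂ = some c →
      StepE E (tBin o (.cst c₁) (.cst c₂)) (.cst c)
  | eqTrue {b w} : Value w → StepE E (tEq b w w) (tBool true)
  | eqFalse {b w₁ w₂} : Value w₁ → Value w₂ → w₁ ≠ w₂ → StepE E (tEq b w₁ w₂) (tBool false)
  | eqFun {σ₁ σ₂ f g b} : E σ₁ σ₂ f g b →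
      StepE E (.app (.app (.cst (.eq (.fn σ₁ σ₂))) f) g) (tBool b)
  | size {t w} : Value w → StepE E (.app (.cst (.size t)) w) (tInt w.dsize)
  | fix (f) : StepE E (.app (.cst .fix) f) (.app f (.app (.cst .fix) f))
  | caseD {t i es} (br) : es.length = arity t i →
      StepE E (.caseD t (Term.apps (.cst (.con t i)) es) br)
        ((br i).subst (subOf (Term.apps (.cst (.con t i)) es :: es)))
  | caseArg {t e e'} (br) : ¬ IsCon t e → StepE E e e' → StepE E (.caseD t e br) (.caseD t e' br)
  | caseTrue (e₁ e₂) : StepE E (.caseB (tBool true) e₁ e₂) (e₁.inst (tBool true))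
  | caseFalse (e₁ e₂) : StepE E (.caseB (tBool false) e₁ e₂) (e₂.inst (tBool false))
  | caseBArg {e e'} (e₁ e₂) : StepE E e e' → StepE E (.caseB e e₁ e₂) (.caseB e' e₁ e₂)
  | letE (τ b₁ b₂) : StepE E (.letE τ b₁ b₂) (b₂.inst (tFix b₁))
  | reflect (τ e p) : StepE E (.reflect τ e p) (.letE τ e p)

/-- Evaluation of source terms, in which function equality has no rule. -/
def Step₀ : Term S → Term S → Prop := StepE (fun _ _ _ _ _ => False)

/-- Extensional equality of functions: on every closed argument value of type `σ`, the results are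
related by the reflexive, symmetric and transitive closure of evaluation. -/
def ExtEq (σ : STy S) (f g : Term S) : Prop :=
  ∀ v : Term S, Value v → STyped [] v σ → Relation.EqvGen Step₀ (.app f v) (.app g v)

/-- Evaluation: equality at function types answers `True` exactly for extensionally equal
functions, and `False` otherwise. -/
def Step : Term S → Term S → Prop :=
  StepE (fun σ₁ _ f g b => b = true ↔ ExtEq σ₁ f g)

/-- `e ↪* e'`. -/
def Steps : Term S → Term S → Prop := Relation.ReflTransGen Step

/-! ## Denotations -/

/-- `e ∈ ⟦τ⟧`, by recursion on the erasure of `τ`. -/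
def DenAt : STy S → RType S → Term S → Prop
  | .base _, .base b l r, e =>
      STyped [] e (.base b) ∧
      (∀ w, Value w → Steps e w → Steps (r.inst w) (tBool true)) ∧
      (l = .tot → ∃ w, Value w ∧ Steps e w)
  | .fn σ₁ σ₂, .fn τ₁ τ₂, e =>
      STyped [] e (RType.fn τ₁ τ₂).erase ∧
      ∀ a, DenAt σ₁ τ₁ a → DenAt σ₂ (τ₂.inst a) (.app e a)
  | _, _, _ => False

/-- The denotation of a closed refinement type, a set of closed terms. -/
def RType.den (τ : RType S) : Set (Term S) := {e | DenAt τ.erase τ e}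

/-- Environments, innermost binding first. The entry at position `i` is a type in the scope of the
variables from `i` on, *including* the variable that it is the type of (as index `0`): this is needed
for reflected types, which mention the function that they describe. -/
abbrev Env (S : DataSig) : Type := List (RType S)

/-- `Γ, x : τ` for a type `τ` in which `x` does not occur. -/
def Env.ext (Γ : Env S) (τ : RType S) : Env S := τ.shift 1 :: Γ

/-- The closing substitutions `θ` with `θ(x) ∈ ⟦θ(τ)⟧` for every binding `x : τ` of `Γ`. -/
def Env.den (Γ : Env S) : Set (List (Term S)) :=
  {θ | θ.length = Γ.length ∧
    ∀ i τ, Γ[i]? = some τ → subOf θ i ∈ ((τ.shift i).subst (subOf θ)).den}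

/-! ## Typing -/

/-- Subtyping. -/
inductive Sub : Env S → RType S → RType S → Prop
  | base {Γ b l₁ l₂ r₁ r₂} :
      (∀ θ ∈ Γ.den, ((RType.base b l₁ r₁).subst (subOf θ)).den ⊆
        ((RType.base b l₂ r₂).subst (subOf θ)).den) →
      Sub Γ (.base b l₁ r₁) (.base b l₂ r₂)
  | fn {Γ τ₁ τ₂ τ₁' τ₂'} :
      Sub Γ τ₁' τ₁ → Sub (Γ.ext τ₁') τ₂ τ₂' → Sub Γ (.fn τ₁ τ₂) (.fn τ₁' τ₂')

/-- Strengthen the refinement of a basic type: `{v : b^l | r ∧ s}`. -/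
def conj (r s : Term S) : Term S := tBin .and r s

/-- `b₁^l → ⋯ → bₖ^l → τ`. -/
def arrowsL (l : Label) (bs : List (Base S.T)) (τ : RType S) : RType S :=
  bs.foldr (fun b τ' => .fn (triv b l) τ') τ

/-- The variables `k - 1 + d, …, d` : the `k` most recent binders, outermost first, seen from below
`d` further binders. -/
def recentVars (k d : ℕ) : List (Term S) :=
  ((List.range k).map (fun j => Term.var (j + d))).reverse

/-- The refinement types of the primitive constants: the result is exactly the application, and
terminates if the arguments do. -/
inductive PrimTy : Label → Cst S → RType S → Prop
  | int (l n) : PrimTy l (.int n) (.base .int .tot (tEq .int (.var 0) (tInt n)))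
  | bool (l b) : PrimTy l (.bool b) (.base .bool .tot (tEq .bool (.var 0) (tBool b)))
  | not (l) : PrimTy l .not
      (.fn (triv .bool l) (.base .bool l (tEq .bool (.var 0) (.app (.cst .not) (.var 1)))))
  | bin (l) (o : BinOp) : PrimTy l (.bin o)
      (.fn (triv o.dom l) (.fn (triv o.dom l)
        (.base o.cod l (tEq o.cod (.var 0) (tBin o (.var 2) (.var 1))))))
  | eq (l b) : PrimTy l (.eq (.base b))
      (.fn (triv b l) (.fn (triv b l)
        (.base .bool l (tEq .bool (.var 0) (tEq b (.var 2) (.var 1))))))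
  | size (l t) : PrimTy l (.size t)
      (.fn (triv (.data t) l) (.base .int l (tEq .int (.var 0) (.app (.cst (.size t)) (.var 1)))))
  | con (l t i) : PrimTy l (.con t i)
      (arrowsL l (S.fields t i)
        (.base (.data t) l (tEq (.data t) (.var 0)
          (Term.apps (.cst (.con t i)) (recentVars (arity t i) 1)))))

/-- `Reflects τ e τ'`: reflecting the definition `e` into the result refinement of `τ` gives `τ'`. -/
inductive Reflects : RType S → Term S → RType S → Prop
  | base (b l r e) :
      Reflects (.base b l r) e (.base b l (conj r (tEq b (.var 0) (e.shift 1))))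
  | fn {τ₁ τ₂ e τ₂'} : Reflects τ₂ e τ₂' → Reflects (.fn τ₁ τ₂) (.lam e) (.fn τ₁ τ₂')

/-- `Guard k g τ τ'`: the parameter at position `k` of the function type `τ` is of the form
`{v : b⇓ | r}`, and `τ'` arises from `τ` by strengthening its refinement to `r ∧ g`. -/
inductive Guard : ℕ → Term S → RType S → RType S → Prop
  | zero (g b r τ) : Guard 0 g (.fn (.base b .tot r) τ) (.fn (.base b .tot (conj r g)) τ)
  | succ {k g τ₁ τ₂ τ₂'} : Guard k g τ₂ τ₂' → Guard (k + 1) g (.fn τ₁ τ₂) (.fn τ₁ τ₂')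

/-- `MetricTy k τ μ`: `μ` is `x₀ : τ₀ → ⋯ → xₖ : τₖ → Int⇓`, where `x₀ : τ₀, …, xₖ : τₖ` are the
parameters of the function type `τ` up to position `k`. -/
inductive MetricTy : ℕ → RType S → RType S → Prop
  | zero (τ₁ τ₂) : MetricTy 0 (.fn τ₁ τ₂) (.fn τ₁ (triv .int .tot))
  | succ {k τ₁ τ₂ μ} : MetricTy k τ₂ μ → MetricTy (k + 1) (.fn τ₁ τ₂) (.fn τ₁ μ)

/-- In the scope `Γ, n, x, y₀, …, y₍ₖ₋₁₎, v`, the term `m y₀ ⋯ y₍ₖ₋₁₎ v`. -/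
def metricAt (k : ℕ) (m : Term S) : Term S :=
  Term.apps (m.shift (k + 3)) (recentVars (k + 1) 0)

/-- In the same scope, `0 ≤ m y₀ ⋯ v ∧ m y₀ ⋯ v < n`. -/
def metricLt (k : ℕ) (m : Term S) : Term S :=
  conj (tBin .le (tInt 0) (metricAt k m)) (tBin .lt (metricAt k m) (.var (k + 2)))

/-- In the same scope, `m y₀ ⋯ v = n`. -/
def metricEq (k : ℕ) (m : Term S) : Term S := tEq .int (metricAt k m) (.var (k + 2))

/-- Typing of source terms, or of the terms that occur in refinements. The latter may in addition
compare functions. -/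
inductive Mode : Type
  | source : Mode
  | logic : Mode

mutual

/-- `Γ ⊢ p : τ`. -/
inductive HasType : Mode → Env S → Term S → RType S → Prop
  | var {m Γ i τ} : Γ[i]? = some τ → HasType m Γ (.var i) (τ.shift i)
  | cst {m Γ l c τ} : PrimTy l c τ → HasType m Γ (.cst c) τ
  | eqFun {Γ σ₁ σ₂} {τ₁ τ₂ : RType S} :
      τ₁.erase = .fn σ₁ σ₂ → τ₂.erase = .fn σ₁ σ₂ →
      HasType .logic Γ (.cst (.eq (.fn σ₁ σ₂)))
        (.fn τ₁ (.fn (τ₂.shift 1) (.base .bool .tot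
          (tEq .bool (.var 0) (.app (.app (.cst (.eq (.fn σ₁ σ₂))) (.var 2)) (.var 1))))))
  | fix {m Γ τ} : τ.MayDiverge →
      HasType m Γ (.cst .fix) (.fn (.fn τ (τ.shift 1)) (τ.shift 1))
  | sub {m Γ p τ' τ} : HasType m Γ p τ' → Sub Γ τ' τ → HasType m Γ p τ
  | exact {m Γ e b l r} : HasType m Γ e (.base b l r) →
      HasType m Γ e (.base b l (conj r (tEq b (.var 0) (e.shift 1))))
  | lam {m Γ e τ₁ τ₂} : HasType m (Γ.ext τ₁) e τ₂ → HasType m Γ (.lam e) (.fn τ₁ τ₂)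
  | app {m Γ e₁ e₂ τ₁ τ₂} : HasType m Γ e₁ (.fn τ₁ τ₂) → HasType m Γ e₂ τ₁ →
      HasType m Γ (.app e₁ e₂) (τ₂.inst e₂)
  | caseD {m Γ t e br l r τ} :
      HasType m Γ e (.base (.data t) l r) →
      (l = .tot ∨ τ.MayDiverge) → WF Γ τ →
      -- the branch of the constructor `i` is typed in `Γ, ȳ : b̄^l, x : {v | r ∧ v = D ȳ}`
      (∀ i, HasType m
        (.base (.data t) l
            (conj (r.rename (upRen (· + (arity t i + 1))))
              (tEq (.data t) (.var 0) (Term.apps (.cst (.con t i))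
                ((List.range (arity t i)).map (fun j => .var (j + 2)))))) ::
          ((S.fields t i).map (fun b => triv b l) ++ Γ))
        (br i) (τ.shift (arity t i + 1))) →
      HasType m Γ (.caseD t e br) τ
  | caseB {m Γ e e₁ e₂ l r τ} :
      HasType m Γ e (.base .bool l r) →
      (l = .tot ∨ τ.MayDiverge) → WF Γ τ →
      HasType m (Γ.ext (.base .bool l (conj r (tEq .bool (.var 0) (tBool true))))) e₁ (τ.shift 1) →
      HasType m (Γ.ext (.base .bool l (conj r (tEq .bool (.var 0) (tBool false))))) e₂ (τ.shift 1) →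
      HasType m Γ (.caseB e e₁ e₂) τ
  | letE {m Γ τx b₁ b₂ τ} :
      DefOk m Γ (τx.shift 1) b₁ → HasType m (τx.shift 1 :: Γ) b₂ (τ.shift 1) → WF Γ τ →
      HasType m Γ (.letE τx b₁ b₂) τ
  | reflect {m Γ τf e p τf' τ} :
      Reflects (τf.shift 1) e τf' →
      DefOk m Γ τf' e → HasType m (τf' :: Γ) p (τ.shift 1) → WF Γ τ →
      HasType m Γ (.reflect τf e p) τ

/-- `DefOk m Γ τ b`: the definition `x = b` of a variable `x : τ` checks, where `τ` and `b` are in the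
scope of `Γ, x`. It may be a recursive definition of type `τ` without a termination mark, or one that
passes the termination check by a decreasing metric, or one that is not recursive. -/
inductive DefOk : Mode → Env S → RType S → Term S → Prop
  | div {m Γ τ b} : τ.MayDiverge → HasType m (τ :: Γ) b τ → DefOk m Γ τ b
  -- for an arbitrary integer `n`, the calls on which the metric is `n` only make calls on which the
  -- metric is non-negative and less than `n`
  | metric {m Γ τ b k μ e τlt τeq} :
      MetricTy k τ (μ.shift 1) → HasType m Γ e μ →
      Guard k (metricLt k e) (τ.rename (upRen (· + 1))) τlt →
      Guard k (metricEq k e) (τ.rename (upRen (· + 1))) τeq →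
      HasType m (τlt :: triv .int .tot :: Γ) (b.rename (upRen (· + 1))) τeq →
      DefOk m Γ τ b
  | nonRec {m Γ τ b} : HasType m Γ b τ → DefOk m Γ (τ.shift 1) (b.shift 1)

/-- Well-formedness `Γ ⊢ τ`: refinements are terminating boolean terms. -/
inductive WF : Env S → RType S → Prop
  | base {Γ b l r} : HasType .logic (Γ.ext (triv b .tot)) r (triv .bool .tot) →
      WF Γ (.base b l r)
  | fn {Γ τ₁ τ₂} : WF Γ τ₁ → WF (Γ.ext τ₁) τ₂ → WF Γ (.fn τ₁ τ₂)

end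

end Refl

namespace Refl

variable {S : DataSig}

/-! ## Substitution calculus -/

theorem upRen_comp (ρ ρ' : ℕ → ℕ) : (fun n => upRen ρ' (upRen ρ n)) = upRen (fun n => ρ' (ρ n)) := by
  funext n; cases n <;> rfl

theorem iterate_upRen_comp (k : ℕ) (ρ ρ' : ℕ → ℕ) :
    (fun n => upRen^[k] ρ' (upRen^[k] ρ n)) = upRen^[k] (fun n => ρ' (ρ n)) := by
  induction k generalizing ρ ρ' with
  | zero => rfl
  | succ k ih => simp only [Function.iterate_succ_apply, ih, upRen_comp]

mutual

theorem Term.rename_rename : (e : Term S) → (ρ ρ' : ℕ → ℕ) →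
    (e.rename ρ).rename ρ' = e.rename (fun n => ρ' (ρ n))
  | .var n, ρ, ρ' => rfl
  | .cst c, _, _ => rfl
  | .lam e, ρ, ρ' => by simp [Term.rename, Term.rename_rename e, upRen_comp]
  | .app e₁ e₂, ρ, ρ' => by
      simp [Term.rename, Term.rename_rename e₁, Term.rename_rename e₂]
  | .caseD t e br, ρ, ρ' => by
      simp only [Term.rename, Term.rename_rename e, fun i => Term.rename_rename (br i),
        iterate_upRen_comp]
  | .caseB e e₁ e₂, ρ, ρ' => by
      simp [Term.rename, Term.rename_rename e, Term.rename_rename e₁, Term.rename_rename e₂,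
        upRen_comp]
  | .letE τ b₁ b₂, ρ, ρ' => by
      simp [Term.rename, RType.rename_rename τ, Term.rename_rename b₁, Term.rename_rename b₂,
        upRen_comp]
  | .reflect τ b₁ b₂, ρ, ρ' => by
      simp [Term.rename, RType.rename_rename τ, Term.rename_rename b₁, Term.rename_rename b₂,
        upRen_comp]

theorem RType.rename_rename : (τ : RType S) → (ρ ρ' : ℕ → ℕ) →
    (τ.rename ρ).rename ρ' = τ.rename (fun n => ρ' (ρ n))
  | .base b l r, ρ, ρ' => by simp [RType.rename, Term.rename_rename r, upRen_comp]
  | .fn τ₁ τ₂, ρ, ρ' => by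
      simp [RType.rename, RType.rename_rename τ₁, RType.rename_rename τ₂, upRen_comp]

end

theorem upSub_upRen (ρ : ℕ → ℕ) (s : ℕ → Term S) :
    (fun n => upSub s (upRen ρ n)) = upSub (fun n => s (ρ n)) := by
  funext n; cases n <;> rfl

theorem iterate_upSub_upRen (k : ℕ) (ρ : ℕ → ℕ) (s : ℕ → Term S) :
    (fun n => upSub^[k] s (upRen^[k] ρ n)) = upSub^[k] (fun n => s (ρ n)) := by
  induction k generalizing ρ s with
  | zero => rfl
  | succ k ih => simp only [Function.iterate_succ_apply, ih, upSub_upRen]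

mutual

theorem Term.subst_rename : (e : Term S) → (ρ : ℕ → ℕ) → (s : ℕ → Term S) →
    (e.rename ρ).subst s = e.subst (fun n => s (ρ n))
  | .var n, ρ, s => rfl
  | .cst c, _, _ => rfl
  | .lam e, ρ, s => by simp [Term.rename, Term.subst, Term.subst_rename e, upSub_upRen]
  | .app e₁ e₂, ρ, s => by
      simp [Term.rename, Term.subst, Term.subst_rename e₁, Term.subst_rename e₂]
  | .caseD t e br, ρ, s => by
      simp only [Term.rename, Term.subst, Term.subst_rename e, fun i => Term.subst_rename (br i),
        iterate_upSub_upRen]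
  | .caseB e e₁ e₂, ρ, s => by
      simp [Term.rename, Term.subst, Term.subst_rename e, Term.subst_rename e₁,
        Term.subst_rename e₂, upSub_upRen]
  | .letE τ b₁ b₂, ρ, s => by
      simp [Term.rename, Term.subst, RType.subst_rename τ, Term.subst_rename b₁,
        Term.subst_rename b₂, upSub_upRen]
  | .reflect τ b₁ b₂, ρ, s => by
      simp [Term.rename, Term.subst, RType.subst_rename τ, Term.subst_rename b₁,
        Term.subst_rename b₂, upSub_upRen]

theorem RType.subst_rename : (τ : RType S) → (ρ : ℕ → ℕ) → (s : ℕ → Term S) →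
    (τ.rename ρ).subst s = τ.subst (fun n => s (ρ n))
  | .base b l r, ρ, s => by simp [RType.rename, RType.subst, Term.subst_rename r, upSub_upRen]
  | .fn τ₁ τ₂, ρ, s => by
      simp [RType.rename, RType.subst, RType.subst_rename τ₁, RType.subst_rename τ₂, upSub_upRen]

end

theorem rename_upSub (ρ : ℕ → ℕ) (s : ℕ → Term S) :
    (fun n => (upSub s n).rename (upRen ρ)) = upSub (fun n => (s n).rename ρ) := by
  funext n
  cases n with
  | zero => rfl
  | succ n => simp [upSub, Term.shift, Term.rename_rename, upRen]

theorem iterate_rename_upSub (k : ℕ) (ρ : ℕ → ℕ) (s : ℕ → Term S) :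
    (fun n => (upSub^[k] s n).rename (upRen^[k] ρ)) = upSub^[k] (fun n => (s n).rename ρ) := by
  induction k generalizing ρ s with
  | zero => rfl
  | succ k ih => simp only [Function.iterate_succ_apply, ih, rename_upSub]

mutual

theorem Term.rename_subst : (e : Term S) → (s : ℕ → Term S) → (ρ : ℕ → ℕ) →
    (e.subst s).rename ρ = e.subst (fun n => (s n).rename ρ)
  | .var n, s, ρ => rfl
  | .cst c, _, _ => rfl
  | .lam e, s, ρ => by simp [Term.rename, Term.subst, Term.rename_subst e, rename_upSub]
  | .app e₁ e₂, s, ρ => by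
      simp [Term.rename, Term.subst, Term.rename_subst e₁, Term.rename_subst e₂]
  | .caseD t e br, s, ρ => by
      simp only [Term.rename, Term.subst, Term.rename_subst e, fun i => Term.rename_subst (br i),
        iterate_rename_upSub]
  | .caseB e e₁ e₂, s, ρ => by
      simp [Term.rename, Term.subst, Term.rename_subst e, Term.rename_subst e₁,
        Term.rename_subst e₂, rename_upSub]
  | .letE τ b₁ b₂, s, ρ => by
      simp [Term.rename, Term.subst, RType.rename_subst τ, Term.rename_subst b₁,
        Term.rename_subst b₂, rename_upSub]
  | .reflect τ b₁ b₂, s, ρ => by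
      simp [Term.rename, Term.subst, RType.rename_subst τ, Term.rename_subst b₁,
        Term.rename_subst b₂, rename_upSub]

theorem RType.rename_subst : (τ : RType S) → (s : ℕ → Term S) → (ρ : ℕ → ℕ) →
    (τ.subst s).rename ρ = τ.subst (fun n => (s n).rename ρ)
  | .base b l r, s, ρ => by simp [RType.rename, RType.subst, Term.rename_subst r, rename_upSub]
  | .fn τ₁ τ₂, s, ρ => by
      simp [RType.rename, RType.subst, RType.rename_subst τ₁, RType.rename_subst τ₂, rename_upSub]

end

theorem Term.subst_shift_upSub (e : Term S) (s : ℕ → Term S) :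
    (e.shift 1).subst (upSub s) = (e.subst s).shift 1 := by
  simp [Term.shift, Term.subst_rename, Term.rename_subst, upSub]

theorem RType.subst_shift_upSub (τ : RType S) (s : ℕ → Term S) :
    (τ.shift 1).subst (upSub s) = (τ.subst s).shift 1 := by
  simp [RType.shift, Term.shift, RType.subst_rename, RType.rename_subst, upSub]

theorem subst_upSub (s t : ℕ → Term S) :
    (fun n => (upSub s n).subst (upSub t)) = upSub (fun n => (s n).subst t) := by
  funext n
  cases n with
  | zero => rfl
  | succ n => exact Term.subst_shift_upSub _ _

theorem iterate_subst_upSub (k : ℕ) (s t : ℕ → Term S) :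
    (fun n => (upSub^[k] s n).subst (upSub^[k] t)) = upSub^[k] (fun n => (s n).subst t) := by
  induction k generalizing s t with
  | zero => rfl
  | succ k ih => simp only [Function.iterate_succ_apply, ih, subst_upSub]

mutual

theorem Term.subst_subst : (e : Term S) → (s t : ℕ → Term S) →
    (e.subst s).subst t = e.subst (fun n => (s n).subst t)
  | .var n, s, t => rfl
  | .cst c, _, _ => rfl
  | .lam e, s, t => by simp [Term.subst, Term.subst_subst e, subst_upSub]
  | .app e₁ e₂, s, t => by
      simp [Term.subst, Term.subst_subst e₁, Term.subst_subst e₂]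
  | .caseD _ e br, s, t => by
      simp only [Term.subst, Term.subst_subst e, fun i => Term.subst_subst (br i),
        iterate_subst_upSub]
  | .caseB e e₁ e₂, s, t => by
      simp [Term.subst, Term.subst_subst e, Term.subst_subst e₁,
        Term.subst_subst e₂, subst_upSub]
  | .letE τ b₁ b₂, s, t => by
      simp [Term.subst, RType.subst_subst τ, Term.subst_subst b₁,
        Term.subst_subst b₂, subst_upSub]
  | .reflect τ b₁ b₂, s, t => by
      simp [Term.subst, RType.subst_subst τ, Term.subst_subst b₁,
        Term.subst_subst b₂, subst_upSub]

theorem RType.subst_subst : (τ : RType S) → (s t : ℕ → Term S) →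
    (τ.subst s).subst t = τ.subst (fun n => (s n).subst t)
  | .base b l r, s, t => by simp [RType.subst, Term.subst_subst r, subst_upSub]
  | .fn τ₁ τ₂, s, t => by
      simp [RType.subst, RType.subst_subst τ₁, RType.subst_subst τ₂, subst_upSub]

end

theorem upSub_var : upSub (Term.var : ℕ → Term S) = Term.var := by
  funext n; cases n <;> rfl

theorem iterate_upSub_var (k : ℕ) : upSub^[k] (Term.var : ℕ → Term S) = Term.var := by
  induction k with
  | zero => rfl
  | succ k ih => rw [Function.iterate_succ_apply, upSub_var, ih]

mutual

theorem Term.subst_var : (e : Term S) → e.subst Term.var = e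
  | .var n => rfl
  | .cst c => rfl
  | .lam e => by simp [Term.subst, upSub_var, Term.subst_var e]
  | .app e₁ e₂ => by simp [Term.subst, Term.subst_var e₁, Term.subst_var e₂]
  | .caseD _ e br => by
      simp only [Term.subst, iterate_upSub_var, Term.subst_var e, fun i => Term.subst_var (br i)]
  | .caseB e e₁ e₂ => by
      simp [Term.subst, upSub_var, Term.subst_var e, Term.subst_var e₁, Term.subst_var e₂]
  | .letE τ b₁ b₂ => by
      simp [Term.subst, upSub_var, RType.subst_var τ, Term.subst_var b₁, Term.subst_var b₂]
  | .reflect τ b₁ b₂ => by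
      simp [Term.subst, upSub_var, RType.subst_var τ, Term.subst_var b₁, Term.subst_var b₂]

theorem RType.subst_var : (τ : RType S) → τ.subst Term.var = τ
  | .base b l r => by simp [RType.subst, upSub_var, Term.subst_var r]
  | .fn τ₁ τ₂ => by simp [RType.subst, upSub_var, RType.subst_var τ₁, RType.subst_var τ₂]

end

theorem Term.rename_eq_subst (e : Term S) (ρ : ℕ → ℕ) : e.rename ρ = e.subst (fun n => .var (ρ n)) := by
  rw [← Term.subst_var (e.rename ρ), Term.subst_rename]

theorem RType.rename_eq_subst (τ : RType S) (ρ : ℕ → ℕ) :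
    τ.rename ρ = τ.subst (fun n => .var (ρ n)) := by
  rw [← RType.subst_var (τ.rename ρ), RType.subst_rename]

theorem subOf_nil : subOf ([] : List (Term S)) = Term.var := by
  funext n; simp [subOf]

@[simp] theorem subOf_cons_zero (a : Term S) (θ : List (Term S)) : subOf (a :: θ) 0 = a := rfl

@[simp] theorem subOf_cons_succ (a : Term S) (θ : List (Term S)) (n : ℕ) :
    subOf (a :: θ) (n + 1) = subOf θ n := by
  simp [subOf]

theorem subOf_append (as θ : List (Term S)) (n : ℕ) :
    subOf (as ++ θ) (n + as.length) = subOf θ n := by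
  induction as with
  | nil => rfl
  | cons a as ih => simpa [← Nat.add_assoc] using ih

theorem subOf_append_left (as θ : List (Term S)) (n : ℕ) (h : n < as.length) :
    subOf (as ++ θ) n = as[n] := by
  simp [subOf, List.getElem?_append_left h, List.getElem?_eq_getElem h]

theorem Term.shift_subst_append (e : Term S) (as θ : List (Term S)) {k : ℕ} (h : as.length = k) :
    (e.shift k).subst (subOf (as ++ θ)) = e.subst (subOf θ) := by
  subst h
  simp [Term.shift, Term.subst_rename, subOf_append]

theorem RType.shift_subst_append (τ : RType S) (as θ : List (Term S)) {k : ℕ} (h : as.length = k) :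
    (τ.shift k).subst (subOf (as ++ θ)) = τ.subst (subOf θ) := by
  subst h
  simp [RType.shift, RType.subst_rename, subOf_append]

theorem RType.shift_subst_cons (τ : RType S) (a : Term S) (θ : List (Term S)) :
    (τ.shift 1).subst (subOf (a :: θ)) = τ.subst (subOf θ) :=
  RType.shift_subst_append τ [a] θ rfl

theorem Term.shift_subst_cons (e a : Term S) (θ : List (Term S)) :
    (e.shift 1).subst (subOf (a :: θ)) = e.subst (subOf θ) :=
  Term.shift_subst_append e [a] θ rfl

@[simp] theorem Term.shift_inst (e a : Term S) : (e.shift 1).inst a = e := by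
  rw [Term.inst, Term.shift_subst_cons, subOf_nil, Term.subst_var]

@[simp] theorem RType.shift_inst (τ : RType S) (a : Term S) : (τ.shift 1).inst a = τ := by
  rw [RType.inst, RType.shift_subst_cons, subOf_nil, RType.subst_var]

theorem upSub_subst_subOf (s : ℕ → Term S) (a : Term S) :
    (fun n => (upSub s n).subst (subOf [a])) = (fun n => match n with | 0 => a | n + 1 => s n) := by
  funext n
  cases n with
  | zero => rfl
  | succ n => exact Term.shift_inst _ _

theorem Term.subst_upSub_inst (e : Term S) (θ : List (Term S)) (a : Term S) :
    (e.subst (upSub (subOf θ))).inst a = e.subst (subOf (a :: θ)) := by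
  rw [Term.inst, Term.subst_subst, upSub_subst_subOf]
  congr 1; funext n; cases n <;> simp

theorem RType.subst_upSub_inst (τ : RType S) (θ : List (Term S)) (a : Term S) :
    (τ.subst (upSub (subOf θ))).inst a = τ.subst (subOf (a :: θ)) := by
  rw [RType.inst, RType.subst_subst, upSub_subst_subOf]
  congr 1; funext n; cases n <;> simp

theorem RType.inst_subst (τ : RType S) (e : Term S) (θ : List (Term S)) :
    (τ.inst e).subst (subOf θ) = τ.subst (subOf (e.subst (subOf θ) :: θ)) := by
  rw [RType.inst, RType.subst_subst]
  congr 1; funext n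
  cases n with
  | zero => simp
  | succ n => simp [subOf_nil, Term.subst]

theorem iterate_upSub_lt (s : ℕ → Term S) {k i : ℕ} (h : i < k) : upSub^[k] s i = .var i := by
  induction k generalizing i with
  | zero => omega
  | succ k ih =>
    rw [Function.iterate_succ_apply']
    cases i with
    | zero => rfl
    | succ i => simp [upSub, ih (Nat.lt_of_succ_lt_succ h), Term.shift, Term.rename]

theorem iterate_upSub_add (s : ℕ → Term S) (k i : ℕ) : upSub^[k] s (i + k) = (s i).shift k := by
  induction k with
  | zero => simp [Term.shift, Term.rename_eq_subst, Term.subst_var]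
  | succ k ih =>
    rw [Function.iterate_succ_apply', ← Nat.add_assoc]
    simp [upSub, ih, Term.shift, Term.rename_rename, Nat.add_assoc]

theorem Term.subst_shift_iterate (e : Term S) (s : ℕ → Term S) (k : ℕ) :
    (e.shift k).subst (upSub^[k] s) = (e.subst s).shift k := by
  simp only [Term.shift, Term.subst_rename, Term.rename_subst, iterate_upSub_add]

theorem Term.shift_shift (e : Term S) (j k : ℕ) : (e.shift j).shift k = e.shift (j + k) := by
  simp [Term.shift, Term.rename_rename, Nat.add_assoc]

theorem Term.shift_zero (e : Term S) : e.shift 0 = e := by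
  simp [Term.shift, Term.rename_eq_subst, Term.subst_var]

theorem RType.shift_zero (τ : RType S) : τ.shift 0 = τ := by
  simp [RType.shift, RType.rename_eq_subst, RType.subst_var]

@[simp] theorem Term.subst_apps (f : Term S) (es : List (Term S)) (s : ℕ → Term S) :
    (Term.apps f es).subst s = Term.apps (f.subst s) (es.map (·.subst s)) := by
  induction es generalizing f with
  | nil => rfl
  | cons e es ih => exact ih _

@[simp] theorem RType.erase_subst : (τ : RType S) → (s : ℕ → Term S) → (τ.subst s).erase = τ.erase
  | .base _ _ _, _ => rfl
  | .fn τ₁ τ₂, _ => by simp [RType.subst, RType.erase, RType.erase_subst τ₁, RType.erase_subst τ₂]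

@[simp] theorem RType.erase_rename (τ : RType S) (ρ : ℕ → ℕ) : (τ.rename ρ).erase = τ.erase := by
  rw [RType.rename_eq_subst, RType.erase_subst]

@[simp] theorem RType.erase_shift (τ : RType S) (k : ℕ) : (τ.shift k).erase = τ.erase :=
  RType.erase_rename _ _

@[simp] theorem RType.erase_inst (τ : RType S) (a : Term S) : (τ.inst a).erase = τ.erase :=
  RType.erase_subst _ _

@[simp] theorem RType.mayDiverge_subst : (τ : RType S) → (s : ℕ → Term S) →
    ((τ.subst s).MayDiverge ↔ τ.MayDiverge)
  | .base _ _ _, _ => Iff.rfl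
  | .fn _ τ₂, _ => by simp [RType.subst, RType.MayDiverge, RType.mayDiverge_subst τ₂]

/-! ### Variables bound by the most recent binders -/

theorem recentVars_succ (k d : ℕ) :
    (recentVars (k + 1) d : List (Term S)) = .var (k + d) :: recentVars k d := by
  simp [recentVars, List.range_succ]

theorem map_subst_recentVars (k d : ℕ) (s : ℕ → Term S) (h : ∀ i < k, s (i + d) = .var (i + d)) :
    (recentVars k d).map (·.subst s) = recentVars k d := by
  simp only [recentVars, List.map_reverse, List.map_map]
  congr 1
  refine List.map_congr_left fun i hi => ?_
  simpa [Term.subst] using h i (by simpa using hi)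

/-- Instantiating the outermost of the recent binders extends the head of the application. -/
theorem apps_recentVars_inst (C a : Term S) (k d : ℕ) :
    (Term.apps (C.shift (k + 1 + d)) (recentVars (k + 1) d)).subst (upSub^[k + d] (subOf [a])) =
      Term.apps ((Term.app C a).shift (k + d)) (recentVars k d) := by
  rw [recentVars_succ, Term.subst_apps, List.map_cons,
    map_subst_recentVars k d _ fun i hi => iterate_upSub_lt _ (by omega)]
  have h1 : (C.shift (k + 1 + d)).subst (upSub^[k + d] (subOf [a])) = C.shift (k + d) := by
    rw [show k + 1 + d = 1 + (k + d) by omega, ← Term.shift_shift, Term.subst_shift_iterate]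
    exact congrArg (Term.shift (k + d)) (Term.shift_inst C a)
  have h2 : upSub^[k + d] (subOf [a]) (k + d) = a.shift (k + d) := by
    simpa using iterate_upSub_add (subOf [a]) (k + d) 0
  simp only [Term.subst, h1, h2]
  rfl

/-! ## Applications to several arguments -/

/-- The head of an iterated application. -/
def Term.head : Term S → Term S
  | .app f _ => f.head
  | e => e

/-- The arguments of an iterated application. -/
def Term.args : Term S → List (Term S)
  | .app f a => f.args ++ [a]
  | _ => []

theorem Term.apps_append (f : Term S) (es es' : List (Term S)) :
    Term.apps f (es ++ es') = Term.apps (Term.apps f es) es' :=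
  List.foldl_append

@[simp] theorem Term.apps_concat (f : Term S) (es : List (Term S)) (a : Term S) :
    Term.apps f (es ++ [a]) = .app (Term.apps f es) a := by
  rw [Term.apps_append]; rfl

@[simp] theorem Term.apps_nil (f : Term S) : Term.apps f [] = f := rfl

@[simp] theorem Term.apps_cons (f a : Term S) (es : List (Term S)) :
    Term.apps f (a :: es) = Term.apps (.app f a) es := rfl

@[simp] theorem Term.head_apps (f : Term S) (es : List (Term S)) :
    (Term.apps f es).head = f.head := by
  induction es generalizing f with
  | nil => rfl
  | cons e es ih => simp [ih, Term.head]

@[simp] theorem Term.args_apps (f : Term S) (es : List (Term S)) :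
    (Term.apps f es).args = f.args ++ es := by
  induction es generalizing f with
  | nil => simp
  | cons e es ih => simp [ih, Term.args]

theorem apps_con_inj {t t' : S.T} {i : Fin (S.ncon t)} {i' : Fin (S.ncon t')}
    {es es' : List (Term S)}
    (h : Term.apps (.cst (.con t i)) es = Term.apps (.cst (.con t' i')) es') :
    (Cst.con t i : Cst S) = .con t' i' ∧ es = es' := by
  have h1 := congrArg Term.head h
  have h2 := congrArg Term.args h
  simpa [Term.head, Term.args] using And.intro h1 h2

/-! ## Simple typing -/

theorem STyped.rename {Δ Δ' : List (STy S)} {e : Term S} {σ : STy S} {ρ : ℕ → ℕ}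
    (h : STyped Δ e σ) (hρ : ∀ i σ, Δ[i]? = some σ → Δ'[ρ i]? = some σ) :
    STyped Δ' (e.rename ρ) σ := by
  have up : ∀ {Δ Δ' : List (STy S)} {ρ : ℕ → ℕ} (σ' : STy S),
      (∀ i σ, Δ[i]? = some σ → Δ'[ρ i]? = some σ) →
      ∀ i σ, (σ' :: Δ)[i]? = some σ → (σ' :: Δ')[upRen ρ i]? = some σ := by
    intro Δ Δ' ρ σ' h i σ hi
    cases i with
    | zero => simpa [upRen] using hi
    | succ i => simpa [upRen] using h i σ (by simpa using hi)
  have ups : ∀ {Δ Δ' : List (STy S)} {ρ : ℕ → ℕ} (l : List (STy S)),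
      (∀ i σ, Δ[i]? = some σ → Δ'[ρ i]? = some σ) →
      ∀ i σ, (l ++ Δ)[i]? = some σ → (l ++ Δ')[upRen^[l.length] ρ i]? = some σ := by
    intro Δ Δ' ρ l h
    induction l with
    | nil => exact h
    | cons σ' l ih =>
      rw [List.length_cons, Function.iterate_succ_apply']
      exact up σ' ih
  induction h generalizing Δ' ρ with
  | var h => exact .var (hρ _ _ h)
  | cst h => exact .cst h
  | lam _ ih => exact .lam (ih (up _ hρ))
  | app _ _ ih₁ ih₂ => exact .app (ih₁ hρ) (ih₂ hρ)
  | @caseD Δ t e br σ _ _ ih₁ ih₂ =>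
    refine .caseD (ih₁ hρ) fun i => ih₂ i ?_
    have := ups (.base (.data t) :: (S.fields t i).map STy.base) hρ
    rw [List.length_cons, List.length_map] at this
    exact this
  | caseB _ _ _ ih ih₁ ih₂ => exact .caseB (ih hρ) (ih₁ (up _ hρ)) (ih₂ (up _ hρ))
  | letE _ _ ih₁ ih₂ =>
    refine .letE ?_ ?_ <;> simp only [RType.erase_rename]
    exacts [ih₁ (up _ hρ), ih₂ (up _ hρ)]
  | reflect _ _ ih₁ ih₂ =>
    refine .reflect ?_ ?_ <;> simp only [RType.erase_rename]
    exacts [ih₁ (up _ hρ), ih₂ (up _ hρ)]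

theorem STyped.shift {Δ : List (STy S)} {e : Term S} {σ : STy S} (h : STyped Δ e σ) (σ' : STy S) :
    STyped (σ' :: Δ) (e.shift 1) σ :=
  h.rename fun i σ hi => by simpa using hi

theorem STyped.subst {Δ Δ' : List (STy S)} {e : Term S} {σ : STy S} {s : ℕ → Term S}
    (h : STyped Δ e σ) (hs : ∀ i σ, Δ[i]? = some σ → STyped Δ' (s i) σ) :
    STyped Δ' (e.subst s) σ := by
  have up : ∀ {Δ Δ' : List (STy S)} {s : ℕ → Term S} (σ' : STy S),
      (∀ i σ, Δ[i]? = some σ → STyped Δ' (s i) σ) →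
      ∀ i σ, (σ' :: Δ)[i]? = some σ → STyped (σ' :: Δ') (upSub s i) σ := by
    intro Δ Δ' s σ' h i σ hi
    cases i with
    | zero => exact .var (by simpa using hi)
    | succ i => exact (h i σ (by simpa using hi)).shift σ'
  have ups : ∀ {Δ Δ' : List (STy S)} {s : ℕ → Term S} (l : List (STy S)),
      (∀ i σ, Δ[i]? = some σ → STyped Δ' (s i) σ) →
      ∀ i σ, (l ++ Δ)[i]? = some σ → STyped (l ++ Δ') (upSub^[l.length] s i) σ := by
    intro Δ Δ' ρ l h
    induction l with
    | nil => exact h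
    | cons σ' l ih =>
      rw [List.length_cons, Function.iterate_succ_apply']
      exact up σ' ih
  induction h generalizing Δ' s with
  | var h => exact hs _ _ h
  | cst h => exact .cst h
  | lam _ ih => exact .lam (ih (up _ hs))
  | app _ _ ih₁ ih₂ => exact .app (ih₁ hs) (ih₂ hs)
  | @caseD Δ t e br σ _ _ ih₁ ih₂ =>
    refine .caseD (ih₁ hs) fun i => ih₂ i ?_
    have := ups (.base (.data t) :: (S.fields t i).map STy.base) hs
    rw [List.length_cons, List.length_map] at this
    exact this
  | caseB _ _ _ ih ih₁ ih₂ => exact .caseB (ih hs) (ih₁ (up _ hs)) (ih₂ (up _ hs))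
  | letE _ _ ih₁ ih₂ =>
    refine .letE ?_ ?_ <;> simp only [RType.erase_subst]
    exacts [ih₁ (up _ hs), ih₂ (up _ hs)]
  | reflect _ _ ih₁ ih₂ =>
    refine .reflect ?_ ?_ <;> simp only [RType.erase_subst]
    exacts [ih₁ (up _ hs), ih₂ (up _ hs)]

theorem STyped.subst_subOf {Δ Δ' : List (STy S)} {e : Term S} {σ : STy S} {as : List (Term S)}
    (h : STyped (Δ ++ Δ') e σ) (has : List.Forall₂ (STyped Δ') as Δ) :
    STyped Δ' (e.subst (subOf as)) σ := by
  refine h.subst fun i σ hi => ?_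
  clear h
  induction has generalizing i with
  | nil => rw [subOf_nil]; exact .var hi
  | cons h _ ih =>
    cases i with
    | zero =>
      obtain rfl : _ = σ := by simpa using hi
      exact h
    | succ i => simpa using ih i (by simpa using hi)

theorem STyped.inst {Δ : List (STy S)} {e a : Term S} {σ σ' : STy S}
    (h : STyped (σ' :: Δ) e σ) (ha : STyped Δ a σ') : STyped Δ (e.inst a) σ :=
  STyped.subst_subOf (Δ := [σ']) h (.cons ha .nil)

theorem STyped.apps_inv {Δ : List (STy S)} {f : Term S} {es : List (Term S)} {σ : STy S}
    (h : STyped Δ (Term.apps f es) σ) :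
    ∃ σs, STyped Δ f (STy.arrows σs σ) ∧ List.Forall₂ (STyped Δ) es σs := by
  induction es generalizing f with
  | nil => exact ⟨[], h, .nil⟩
  | cons e es ih =>
    obtain ⟨σs, h₁, h₂⟩ := ih h
    cases h₁ with
    | app h₁ h₃ => exact ⟨_ :: σs, h₁, .cons h₃ h₂⟩

theorem arrows_eq_arrows_base {σs : List (STy S)} {σ : STy S} {bs : List (Base S.T)} {b : Base S.T}
    (h : STy.arrows σs σ = STy.arrows (bs.map .base) (.base b)) :
    ∃ bs₁ bs₂, bs = bs₁ ++ bs₂ ∧ σs = bs₁.map .base ∧ σ = STy.arrows (bs₂.map .base) (.base b) := by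
  induction σs generalizing bs with
  | nil => exact ⟨[], bs, rfl, rfl, h⟩
  | cons σ' σs ih =>
    cases bs with
    | nil => simp [STy.arrows] at h
    | cons b' bs =>
      simp only [STy.arrows, List.foldr_cons, List.map_cons, STy.fn.injEq] at h
      obtain ⟨bs₁, bs₂, rfl, rfl, rfl⟩ := ih h.2
      exact ⟨b' :: bs₁, bs₂, rfl, by simp [h.1], rfl⟩

theorem STyped.con_apps_inv {Δ : List (STy S)} {t : S.T} {i : Fin (S.ncon t)} {es : List (Term S)}
    {σ : STy S} (h : STyped Δ (Term.apps (.cst (.con t i)) es) σ) :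
    ∃ bs₁ bs₂, S.fields t i = bs₁ ++ bs₂ ∧ σ = STy.arrows (bs₂.map .base) (.base (.data t)) ∧
      List.Forall₂ (STyped Δ) es (bs₁.map .base) := by
  obtain ⟨σs, h₁, h₂⟩ := h.apps_inv
  cases h₁ with
  | cst h₁ =>
    generalize hσ : STy.arrows σs σ = σ' at h₁
    cases h₁
    obtain ⟨bs₁, bs₂, hbs, rfl, rfl⟩ := arrows_eq_arrows_base hσ
    exact ⟨bs₁, bs₂, hbs, rfl, h₂⟩

theorem STyped.con_apps_base {Δ : List (STy S)} {t : S.T} {i : Fin (S.ncon t)}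
    {es : List (Term S)} {b : Base S.T} (h : STyped Δ (Term.apps (.cst (.con t i)) es) (.base b)) :
    b = .data t ∧ List.Forall₂ (STyped Δ) es ((S.fields t i).map .base) := by
  obtain ⟨bs₁, bs₂, h₁, h₂, h₃⟩ := h.con_apps_inv
  cases bs₂ with
  | nil =>
    rw [h₁, List.append_nil]
    simp only [STy.arrows, List.map_nil, List.foldr_nil, STy.base.injEq] at h₂
    exact ⟨h₂, h₃⟩
  | cons => simp [STy.arrows] at h₂

theorem STyped.not_eq_fn {Δ : List (STy S)} {σ₁ σ₂ σ : STy S} :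
    ¬ STyped Δ (.cst (.eq (.fn σ₁ σ₂))) σ := by
  intro h
  cases h with
  | cst h => cases h

/-! ## Values -/

/-- Values of basic type: literals and constructors applied to such values. -/
inductive Ground : Term S → Prop
  | int (n : ℤ) : Ground (tInt n)
  | bool (b : Bool) : Ground (tBool b)
  | con (t : S.T) (i : Fin (S.ncon t)) (ws : List (Term S)) :
      (∀ w ∈ ws, Ground w) → Ground (Term.apps (.cst (.con t i)) ws)

theorem Value.args_con {w : Term S} (hw : Value w) {t : S.T} {i : Fin (S.ncon t)}
    {ws : List (Term S)} (h : w = Term.apps (.cst (.con t i)) ws) : ∀ w ∈ ws, Value w := by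
  have h₁ := congrArg Term.head h
  have h₂ := congrArg Term.args h
  cases hw with
  | cst c =>
    simp only [Term.args, Term.args_apps, List.nil_append] at h₂
    simp [← h₂]
  | lam e => simp [Term.head] at h₁
  | con t' i' ws' hl hv =>
    simp only [Term.args, Term.args_apps, List.nil_append] at h₂
    exact h₂ ▸ hv
  | partialPrim c w hc hw =>
    simp [Term.head] at h₁
    simp [h₁, Cst.Strict₂] at hc
  | partialEq σ₁ σ₂ f => simp [Term.head] at h₁

theorem Value.ground {w : Term S} (hw : Value w) {b : Base S.T} (h : STyped [] w (.base b)) :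
    Ground w := by
  induction hw generalizing b with
  | cst c =>
    cases h with
    | cst h =>
      generalize hσ : STy.base b = σ at h
      cases h with
      | int n => exact .int n
      | bool b => exact .bool b
      | con t i => exact .con t i [] (by simp)
      | _ => simp at hσ
  | lam e => cases h
  | con t i ws hl hv ih =>
    refine .con t i ws fun w hw => ?_
    obtain ⟨-, hws⟩ := h.con_apps_base
    obtain ⟨σ, hσ, h⟩ : ∃ σ ∈ (S.fields t i).map STy.base, STyped [] w σ := by
      clear ih hl hv h
      generalize (S.fields t i).map STy.base = σs at hws
      induction hws with
      | nil => simp at hw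
      | cons h _ ih =>
        rcases List.mem_cons.1 hw with rfl | hw
        · exact ⟨_, by simp, h⟩
        · obtain ⟨σ, h₁, h₂⟩ := ih hw
          exact ⟨σ, by simp [h₁], h₂⟩
    obtain ⟨b, -, rfl⟩ := List.mem_map.1 hσ
    exact ih w hw h
  | partialPrim c w hc =>
    cases h with
    | app h _ =>
      cases h with
      | cst h =>
        generalize hσ : STy.fn _ (STy.base b) = σ at h
        cases h <;> simp_all [Cst.Strict₂]
  | partialEq σ₁ σ₂ f =>
    cases h with
    | app h _ => exact absurd h STyped.not_eq_fn

theorem Value.eq_tInt {w : Term S} (hw : Value w) (h : STyped [] w (.base .int)) :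
    ∃ n, w = tInt n := by
  cases hw.ground h with
  | int n => exact ⟨n, rfl⟩
  | bool b => cases h with | cst h => cases h
  | con t i ws => exact nomatch h.con_apps_base.1

theorem Value.eq_tBool {w : Term S} (hw : Value w) (h : STyped [] w (.base .bool)) :
    ∃ b, w = tBool b := by
  cases hw.ground h with
  | int n => cases h with | cst h => cases h
  | bool b => exact ⟨b, rfl⟩
  | con t i ws => exact nomatch h.con_apps_base.1

theorem Value.isCon {w : Term S} (hw : Value w) {t : S.T} (h : STyped [] w (.base (.data t))) :
    IsCon t w := by
  cases hw.ground h with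
  | int n => cases h with | cst h => cases h
  | bool b => cases h with | cst h => cases h
  | con t' i ws =>
    obtain ⟨h₁, h₂⟩ := h.con_apps_base
    cases h₁
    exact ⟨i, ws, by simpa [arity] using h₂.length_eq, rfl⟩

theorem Value.of_app {f a : Term S} (h : Value (.app f a)) : Value f := by
  generalize he : Term.app f a = e at h
  cases h with
  | cst => cases he
  | lam => cases he
  | con t i ws hl hv =>
    rcases List.eq_nil_or_concat ws with rfl | ⟨ws, b, rfl⟩
    · cases he
    · simp only [List.concat_eq_append, Term.apps_concat, Term.app.injEq] at he
      rw [he.1]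
      exact .con t i ws (by simp at hl; omega) fun w hw => hv w (by simp [hw])
  | partialPrim => cases he; exact .cst _
  | partialEq => cases he; exact .cst _

/-! ## Evaluation -/

theorem step_con_apps {t : S.T} {i : Fin (S.ncon t)} {es : List (Term S)} {e : Term S}
    (h : Step (Term.apps (.cst (.con t i)) es) e) :
    ∃ ws a a' es', es = ws ++ a :: es' ∧ e = Term.apps (.cst (.con t i)) (ws ++ a' :: es') ∧
      ws.length < arity t i ∧ (∀ w ∈ ws, Value w) ∧ Step a a' := by
  induction es using List.reverseRecOn generalizing e with
  | nil => cases h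
  | append_singleton es b ih =>
    rw [Term.apps_concat] at h
    generalize hf : Term.apps (.cst (.con t i)) es = f at h
    have h₁ := congrArg Term.head hf
    have h₂ := congrArg Term.args hf
    cases h with
    | appL _ h =>
      rw [← hf] at h
      obtain ⟨ws, a, a', es', rfl, rfl, hl, hv, h⟩ := ih h
      exact ⟨ws, a, a', es' ++ [b], by simp, by simp [← Term.apps_concat], hl, hv, h⟩
    | conArg hl hv h =>
      clear h₁ h₂
      obtain ⟨hc, rfl⟩ := apps_con_inj hf
      cases hc
      exact ⟨_, b, _, [], by simp, by simp, hl, hv, h⟩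
    | primArg hc => simp [Term.head] at h₁; simp [← h₁, Cst.Strict] at hc
    | primArg₂ hc => simp [Term.head] at h₁; simp [← h₁, Cst.Strict₂] at hc
    | _ => simp [Term.head] at h₁

theorem Value.not_step {w e : Term S} (hw : Value w) : ¬ Step w e := by
  intro h
  induction hw generalizing e with
  | cst => cases h
  | lam => cases h
  | con t i ws hl hv ih =>
    obtain ⟨ws', a, a', es', rfl, -, -, -, h⟩ := step_con_apps h
    exact ih a (by simp) h
  | partialPrim c w hc hw ih =>
    generalize hf : Term.cst c = f at h
    have h₁ := congrArg Term.head hf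
    cases h with
    | primArg _ h => exact ih h
    | appL _ h => rw [← hf] at h; cases h
    | conArg _ _ h => exact ih h
    | _ => simp_all [Term.head, Cst.Strict₂]
  | partialEq σ₁ σ₂ f =>
    generalize hf : Term.cst (Cst.eq (STy.fn σ₁ σ₂)) = f at h
    have h₁ := congrArg Term.head hf
    cases h with
    | appL _ h => rw [← hf] at h; cases h
    | primArg hc => cases hf; exact hc
    | _ => simp_all [Term.head]

theorem IsCon.step {t : S.T} {e e' : Term S} (h : IsCon t e) (hs : Step e e') : IsCon t e' := by
  obtain ⟨i, es, hl, rfl⟩ := h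
  obtain ⟨ws, a, a', es', rfl, rfl, -⟩ := step_con_apps hs
  exact ⟨i, _, by simpa using hl, rfl⟩

theorem STyped.step {e e' : Term S} {σ : STy S} (h : STyped [] e σ) (hs : Step e e') :
    STyped [] e' σ := by
  induction hs generalizing σ with
  | beta e a =>
    cases h with
    | app h h' => cases h with | lam h => exact h.inst h'
  | appL a _ ih => cases h with | app h h' => exact .app (ih h) h'
  | primArg _ _ ih => cases h with | app h h' => exact .app h (ih h')
  | primArg₂ _ _ _ ih => cases h with | app h h' => exact .app h (ih h')
  | conArg _ _ _ ih => cases h with | app h h' => exact .app h (ih h')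
  | not b =>
    cases h with
    | app h _ => cases h with | cst h => cases h; exact .cst (.bool _)
  | @bin o c₁ c₂ c hc =>
    cases h with
    | app h _ => cases h with
      | app h _ => cases h with
        | cst h =>
          cases h
          cases o <;> cases c₁ <;> cases c₂ <;> simp [BinOp.eval] at hc <;> subst hc <;>
            first | exact .cst (.bool _) | exact .cst (.int _)
  | eqTrue _ =>
    cases h with
    | app h _ => cases h with
      | app h _ => cases h with | cst h => cases h; exact .cst (.bool _)
  | eqFalse _ _ =>
    cases h with
    | app h _ => cases h with
      | app h _ => cases h with | cst h => cases h; exact .cst (.bool _)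
  | eqFun _ =>
    cases h with
    | app h _ => cases h with | app h _ => exact absurd h STyped.not_eq_fn
  | size _ =>
    cases h with
    | app h _ => cases h with | cst h => cases h; exact .cst (.int _)
  | fix f =>
    cases h with
    | app h h' => cases h with
      | cst h => cases h with | fix => exact .app h' (.app (.cst (.fix _)) h')
  | @caseD t i es br hl =>
    cases h with
    | caseD h h' =>
      refine STyped.subst_subOf (Δ := .base (.data t) :: (S.fields t i).map STy.base) (h' i)
        (.cons h h.con_apps_base.2)
  | caseArg br _ _ ih => cases h with | caseD h h' => exact .caseD (ih h) h'
  | caseTrue => cases h with | caseB h h₁ h₂ => exact h₁.inst h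
  | caseFalse => cases h with | caseB h h₁ h₂ => exact h₂.inst h
  | caseBArg _ _ _ ih => cases h with | caseB h h₁ h₂ => exact .caseB (ih h) h₁ h₂
  | letE τ b₁ b₂ =>
    cases h with | letE h₁ h₂ => exact h₂.inst (.app (.cst (.fix _)) (.lam h₁))
  | reflect τ b₁ b₂ => cases h with | reflect h₁ h₂ => exact .letE h₁ h₂

theorem STyped.steps {e e' : Term S} {σ : STy S} (h : STyped [] e σ) (hs : Steps e e') :
    STyped [] e' σ := by
  induction hs with
  | refl => exact h
  | tail _ hs ih => exact ih.step hs

theorem not_step_con_apps {t : S.T} {i : Fin (S.ncon t)} {ws : List (Term S)}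
    (hv : ∀ w ∈ ws, Value w) {e : Term S} : ¬ Step (Term.apps (.cst (.con t i)) ws) e := by
  intro h
  obtain ⟨ws', a, a', es', rfl, -, -, -, h⟩ := step_con_apps h
  exact (hv a (by simp)).not_step h

theorem Step.det {e e₁ e₂ : Term S} (h₁ : Step e e₁) (h₂ : Step e e₂) : e₁ = e₂ := by
  induction h₁ generalizing e₂ with
  | beta e a =>
    generalize hf : Term.lam e = f at h₂
    have hh := congrArg Term.head hf
    cases h₂ with
    | beta => cases hf; rfl
    | appL _ h => rw [← hf] at h; cases h
    | _ => simp [Term.head] at hh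
  | appL a h ih =>
    cases h₂ with
    | appL _ h' => rw [ih h']
    | beta => cases h
    | primArg => cases h
    | primArg₂ hc hw => exact absurd h (Value.partialPrim _ _ hc hw).not_step
    | conArg hl hv => exact absurd h (not_step_con_apps hv)
    | not => cases h
    | @bin o => exact absurd h (Value.partialPrim (.bin o) _ trivial (.cst _)).not_step
    | @eqTrue b _ hw => exact absurd h (Value.partialPrim (.eq (.base b)) _ trivial hw).not_step
    | @eqFalse b _ _ hw => exact absurd h (Value.partialPrim (.eq (.base b)) _ trivial hw).not_step
    | eqFun => exact absurd h (Value.partialEq _ _ _).not_step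
    | size => cases h
    | fix => cases h
  | @primArg c a a' hc h ih =>
    generalize hf : Term.cst c = f at h₂
    have hh := congrArg Term.head hf
    cases h₂ with
    | appL _ h' => rw [← hf] at h'; cases h'
    | primArg _ h' => cases hf; rw [ih h']
    | conArg => simp [Term.head] at hh; simp [hh, Cst.Strict] at hc
    | not => cases h
    | size hw => exact absurd h hw.not_step
    | fix => cases hf; exact hc.elim
    | _ => cases hf
  | @primArg₂ c w a a' hc hw h ih =>
    generalize hf : Term.app (Term.cst c) w = f at h₂
    have hh := congrArg Term.head hf
    cases h₂ with
    | appL _ h' => rw [← hf] at h'; exact absurd h' (Value.partialPrim _ _ hc hw).not_step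
    | primArg₂ _ _ h' => rw [ih h']
    | conArg => simp [Term.head] at hh; simp [hh, Cst.Strict₂] at hc
    | bin => cases h
    | eqTrue hw' => exact absurd h hw'.not_step
    | eqFalse _ hw' => exact absurd h hw'.not_step
    | eqFun => cases hf; exact hc.elim
    | _ => cases hf
  | @conArg t i ws a a' hl hv h ih =>
    generalize hf : Term.apps (Term.cst (Cst.con t i)) ws = f at h₂
    have hh := congrArg Term.head hf
    cases h₂ with
    | appL _ h' => rw [← hf] at h'; exact absurd h' (not_step_con_apps hv)
    | primArg hc => simp [Term.head] at hh; simp [← hh, Cst.Strict] at hc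
    | primArg₂ hc => simp [Term.head] at hh; simp [← hh, Cst.Strict₂] at hc
    | conArg _ _ h' => rw [ih h']
    | _ => simp [Term.head] at hh
  | not b =>
    generalize hf : Term.cst Cst.not = f at h₂
    generalize hb : tBool b = e at h₂
    have hh := congrArg Term.head hf
    cases h₂ with
    | appL _ h => rw [← hf] at h; cases h
    | primArg _ h => rw [← hb] at h; cases h
    | not => cases hb; rfl
    | primArg₂ => cases hf
    | _ => simp [Term.head] at hh
  | @bin o c₁ c₂ c hc =>
    unfold tBin at h₂
    generalize hf : Term.app (Term.cst (Cst.bin o)) (Term.cst c₁) = f at h₂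
    generalize hb : Term.cst c₂ = e at h₂
    have hh := congrArg Term.head hf
    cases h₂ with
    | appL _ h =>
      rw [← hf] at h; exact absurd h (Value.partialPrim (.bin o) _ trivial (.cst _)).not_step
    | primArg₂ _ _ h => rw [← hb] at h; cases h
    | bin hc' => cases hf; cases hb; rw [hc] at hc'; cases hc'; rfl
    | conArg => simp [Term.head] at hh
    | eqTrue | eqFalse | eqFun => simp [Term.head] at hh
    | _ => cases hf
  | @eqTrue b w hw =>
    unfold tEq at h₂
    generalize hf : Term.app (Term.cst (Cst.eq (.base b))) w = f at h₂
    generalize hb : w = e at h₂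
    have hh := congrArg Term.head hf
    cases h₂ with
    | appL _ h =>
      rw [← hf] at h; exact absurd h (Value.partialPrim (.eq (.base b)) _ trivial hw).not_step
    | primArg₂ _ _ h => rw [← hb] at h; exact absurd h hw.not_step
    | conArg _ _ h => rw [← hb] at h; exact absurd h hw.not_step
    | eqTrue => rfl
    | eqFalse _ _ hne => cases hf; exact absurd hb hne
    | bin | eqFun => simp [Term.head] at hh
    | _ => cases hf
  | @eqFalse b w w' hw hw' hne =>
    unfold tEq at h₂
    generalize hf : Term.app (Term.cst (Cst.eq (.base b))) w = f at h₂
    have hh := congrArg Term.head hf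
    cases h₂ with
    | appL _ h =>
      rw [← hf] at h; exact absurd h (Value.partialPrim (.eq (.base b)) _ trivial hw).not_step
    | primArg₂ _ _ h => exact absurd h hw'.not_step
    | conArg _ _ h => exact absurd h hw'.not_step
    | eqTrue => cases hf; exact absurd rfl hne
    | eqFalse => rfl
    | bin | eqFun => simp [Term.head] at hh
    | _ => cases hf
  | @eqFun σ₁ σ₂ f g b hb =>
    generalize hf : Term.app (Term.cst (Cst.eq (.fn σ₁ σ₂))) f = f' at h₂
    have hh := congrArg Term.head hf
    cases h₂ with
    | appL _ h => rw [← hf] at h; exact absurd h (Value.partialEq _ _ _).not_step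
    | primArg₂ hc => cases hf; exact hc.elim
    | eqFun hb' =>
      cases hf
      rename_i b'
      have : b = true ↔ b' = true := hb.trans hb'.symm
      cases b <;> cases b' <;> simp_all
    | conArg | bin | eqTrue | eqFalse => simp [Term.head] at hh
    | _ => cases hf
  | @size t w hw =>
    generalize hf : Term.cst (Cst.size t) = f at h₂
    have hh := congrArg Term.head hf
    cases h₂ with
    | appL _ h => rw [← hf] at h; cases h
    | primArg _ h => exact absurd h hw.not_step
    | size => rfl
    | conArg | fix | not => simp [Term.head] at hh
    | _ => cases hf
  | fix f =>
    generalize hf : Term.cst Cst.fix = f' at h₂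
    have hh := congrArg Term.head hf
    cases h₂ with
    | appL _ h => rw [← hf] at h; cases h
    | primArg hc => cases hf; exact hc.elim
    | fix => rfl
    | conArg | size | not => simp [Term.head] at hh
    | _ => cases hf
  | @caseD t i es br hl =>
    generalize hs : Term.apps (.cst (.con t i)) es = e at h₂
    cases h₂ with
    | caseD =>
      obtain ⟨hc, rfl⟩ := apps_con_inj hs
      cases hc
      rfl
    | caseArg _ hn => exact absurd ⟨i, es, hl, hs.symm⟩ hn
  | caseArg br hn h ih =>
    cases h₂ with
    | caseD _ hl => exact absurd ⟨_, _, hl, rfl⟩ hn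
    | caseArg _ _ h' => rw [ih h']
  | caseTrue =>
    cases h₂ with
    | caseTrue => rfl
    | caseBArg _ _ h => cases h
  | caseFalse =>
    cases h₂ with
    | caseFalse => rfl
    | caseBArg _ _ h => cases h
  | caseBArg e₁ e₂ h ih =>
    cases h₂ with
    | caseTrue => cases h
    | caseFalse => cases h
    | caseBArg _ _ h' => rw [ih h']
  | letE => cases h₂; rfl
  | reflect => cases h₂; rfl

theorem Steps.of_steps_value {e e' w : Term S} (h : Steps e e') (hw : Steps e w) (hv : Value w) :
    Steps e' w := by
  induction h using Relation.ReflTransGen.head_induction_on with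
  | refl => exact hw
  | head h _ ih =>
    refine ih ?_
    rcases Relation.ReflTransGen.cases_head hw with rfl | ⟨c, hc, hcw⟩
    · exact absurd h hv.not_step
    · rwa [h.det hc]

theorem Steps.value_unique {e w w' : Term S} (hw : Steps e w) (hv : Value w) (hw' : Steps e w')
    (hv' : Value w') : w = w' := by
  rcases Relation.ReflTransGen.cases_head (hw.of_steps_value hw' hv') with h | ⟨c, hc, -⟩
  · exact h
  · exact absurd hc hv.not_step

theorem value_tBool (b : Bool) : Value (tBool b : Term S) := .cst _

theorem value_tInt (n : ℤ) : Value (tInt n : Term S) := .cst _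

/-! ### Evaluation in contexts -/

theorem Steps.map {F : Term S → Term S} (hF : ∀ e e', Step e e' → Step (F e) (F e'))
    {e e' : Term S} (h : Steps e e') : Steps (F e) (F e') := by
  induction h with
  | refl => exact .refl
  | tail _ h ih => exact ih.tail (hF _ _ h)

theorem Steps.appL {f f' : Term S} (h : Steps f f') (a : Term S) :
    Steps (.app f a) (.app f' a) :=
  h.map (F := (.app · a)) fun _ _ h => .appL a h

theorem Steps.apps {f f' : Term S} (h : Steps f f') (as : List (Term S)) :
    Steps (Term.apps f as) (Term.apps f' as) := by
  induction as generalizing f f' with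
  | nil => exact h
  | cons a as ih => exact ih (h.appL a)

theorem Steps.primArg {c : Cst S} {a a' : Term S} (hc : c.Strict) (h : Steps a a') :
    Steps (.app (.cst c) a) (.app (.cst c) a') :=
  h.map fun _ _ h => .primArg hc h

theorem Steps.primArg₂ {c : Cst S} {w a a' : Term S} (hc : c.Strict₂) (hw : Value w)
    (h : Steps a a') : Steps (.app (.app (.cst c) w) a) (.app (.app (.cst c) w) a') :=
  h.map fun _ _ h => .primArg₂ hc hw h

theorem Cst.Strict₂.strict {c : Cst S} (hc : c.Strict₂) : c.Strict := by
  cases c with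
  | eq σ => cases σ <;> exact hc
  | _ => first | exact hc | trivial

/-- Both arguments of a strict constant are evaluated. -/
theorem Steps.prim₂ {c : Cst S} {a b w b' : Term S} (hc : c.Strict₂) (ha : Steps a w) (hw : Value w)
    (hb : Steps b b') : Steps (.app (.app (.cst c) a) b) (.app (.app (.cst c) w) b') :=
  ((ha.primArg hc.strict).appL b).trans (hb.primArg₂ hc hw)

theorem Steps.tBin {o : BinOp} {a b : Term S} {c₁ c₂ c : Cst S} (ha : Steps a (.cst c₁))
    (hb : Steps b (.cst c₂)) (h : BinOp.eval o c₁ c₂ = some c) : Steps (tBin o a b) (.cst c) :=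
  (Steps.prim₂ (c := .bin o) trivial ha (.cst _) hb).tail (.bin h)

theorem Steps.tEq {β : Base S.T} {a b w : Term S} (hw : Value w) (ha : Steps a w)
    (hb : Steps b w) : Steps (tEq β a b) (tBool true) :=
  (Steps.prim₂ (c := .eq (.base β)) trivial ha hw hb).tail (.eqTrue hw)

theorem Steps.conj {r s : Term S} (hr : Steps r (tBool true)) (hs : Steps s (tBool true)) :
    Steps (conj r s) (tBool true) :=
  Steps.tBin hr hs rfl

theorem Steps.of_conj {r s : Term S} (h : Steps (Refl.conj r s) (tBool true)) :
    Steps r (tBool true) ∧ Steps s (tBool true) := by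
  generalize he : Refl.conj r s = e at h
  induction h using Relation.ReflTransGen.head_induction_on generalizing r s with
  | refl => cases he
  | head h _ ih =>
    subst he
    generalize hf : Term.app (Term.cst (Cst.bin .and)) r = f at h
    unfold Refl.conj Refl.tBin at h
    rw [hf] at h
    have hh := congrArg Term.head hf
    cases h with
    | appL _ h =>
      rw [← hf] at h
      generalize hg : Term.cst (Cst.bin .and) = g at h
      have hh' := congrArg Term.head hg
      cases h with
      | appL _ h => rw [← hg] at h; cases h
      | primArg _ h =>
        cases hg
        obtain ⟨h₁, h₂⟩ := ih rfl
        exact ⟨h₁.head h, h₂⟩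
      | primArg₂ | bin => cases hg
      | _ => simp [Term.head] at hh'
    | primArg₂ _ _ h =>
      cases hf
      obtain ⟨h₁, h₂⟩ := ih rfl
      exact ⟨h₁, h₂.head h⟩
    | @bin o c₁ c₂ c hc =>
      cases hf
      rename_i hst
      cases c₁ <;> cases c₂ <;> simp [BinOp.eval] at hc
      subst hc
      have := Steps.value_unique hst (value_tBool true) .refl (.cst _)
      simp only [Refl.tBool, Term.cst.injEq, Cst.bool.injEq] at this
      rename_i a b
      cases a <;> cases b <;> simp at this
      exact ⟨.refl, .refl⟩
    | conArg => simp [Term.head] at hh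
    | eqTrue | eqFalse | eqFun => simp [Term.head] at hh
    | _ => cases hf

/-! ### Evaluation of constructor arguments -/

theorem Steps.con_apps {t : S.T} {i : Fin (S.ncon t)} {es ws : List (Term S)}
    (hl : es.length ≤ arity t i) (h : List.Forall₂ (fun e w => Value w ∧ Steps e w) es ws) :
    Steps (Term.apps (.cst (.con t i)) es) (Term.apps (.cst (.con t i)) ws) := by
  suffices H : ∀ vs : List (Term S), (∀ v ∈ vs, Value v) → vs.length + es.length ≤ arity t i →
      Steps (Term.apps (.cst (.con t i)) (vs ++ es)) (Term.apps (.cst (.con t i)) (vs ++ ws)) from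
    H [] (by simp) (by simpa using hl)
  clear hl
  induction h with
  | nil => exact fun _ _ _ => .refl
  | @cons e w es ws h _ ih =>
    intro vs hv hl
    rw [List.length_cons] at hl
    have h₁ : Steps (Term.apps (.cst (.con t i)) (vs ++ e :: es))
        (Term.apps (.cst (.con t i)) (vs ++ w :: es)) := by
      rw [Term.apps_append, Term.apps_append]
      refine Steps.apps (h.2.map fun _ _ h => ?_) es
      exact .conArg (by omega) hv h
    have h₂ := ih (vs ++ [w]) (by
      intro v hv'
      rcases List.mem_append.1 hv' with hv' | hv'
      · exact hv v hv'
      · rw [List.mem_singleton.1 hv']; exact h.1) (by simp; omega)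
    simp only [List.append_assoc, List.singleton_append] at h₂
    exact h₁.trans h₂

theorem Steps.con_apps_inv {t : S.T} {i : Fin (S.ncon t)} {es : List (Term S)} {w : Term S}
    (h : Steps (Term.apps (.cst (.con t i)) es) w) (hw : Value w) :
    ∃ ws, w = Term.apps (.cst (.con t i)) ws ∧
      List.Forall₂ (fun e w => Value w ∧ Steps e w) es ws := by
  generalize he : Term.apps (.cst (.con t i)) es = e at h
  induction h using Relation.ReflTransGen.head_induction_on generalizing es with
  | refl =>
    refine ⟨es, he.symm, ?_⟩
    have := hw.args_con he.symm
    exact List.forall₂_same.2 fun e he => ⟨this e he, .refl⟩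
  | head h _ ih =>
    subst he
    obtain ⟨vs, a, a', es', rfl, rfl, -, -, h⟩ := step_con_apps h
    obtain ⟨ws, rfl, hws⟩ := ih rfl
    refine ⟨ws, rfl, ?_⟩
    rename_i h₁ h₂
    clear ih h₁ h₂ hw
    induction vs generalizing ws with
    | nil =>
      cases hws with
      | cons h₁ h₂ => exact .cons ⟨h₁.1, .head h h₁.2⟩ h₂
    | cons v vs ihv =>
      cases hws with
      | cons h₁ h₂ => exact .cons h₁ (ihv _ h₂)

/-! ### Terms without a value -/

/-- Evaluation of `e` does not reach a value. -/
def NoVal (e : Term S) : Prop := ∀ w, Value w → ¬ Steps e w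

theorem NoVal.step {e e' : Term S} (h : NoVal e) (hs : Step e e') : NoVal e' :=
  fun w hw h' => h w hw (h'.head hs)

theorem NoVal.app {e : Term S} (h : NoVal e) (a : Term S) : NoVal (.app e a) := by
  intro w hw hs
  generalize he : Term.app e a = e' at hs
  induction hs using Relation.ReflTransGen.head_induction_on generalizing e with
  | refl => subst he; exact h e hw.of_app .refl
  | head hs _ ih =>
    subst he
    have hv : ¬ Value e := fun hv => h e hv .refl
    cases hs with
    | appL _ hs => exact ih (h.step hs) rfl
    | beta => exact hv (.lam _)
    | primArg => exact hv (.cst _)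
    | primArg₂ hc hw => exact hv (.partialPrim _ _ hc hw)
    | conArg hl hv' => exact hv (.con _ _ _ hl.le hv')
    | not => exact hv (.cst _)
    | bin => exact hv (.partialPrim _ _ trivial (.cst _))
    | eqTrue hw => exact hv (.partialPrim _ _ trivial hw)
    | eqFalse hw => exact hv (.partialPrim _ _ trivial hw)
    | eqFun => exact hv (.partialEq _ _ _)
    | size => exact hv (.cst _)
    | fix => exact hv (.cst _)

theorem Steps.caseD_scrut {t : S.T} {e c : Term S} (br : Fin (S.ncon t) → Term S)
    (h : Steps e c) (hc : IsCon t c) :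
    ∃ c', IsCon t c' ∧ Steps e c' ∧ Steps (.caseD t e br) (.caseD t c' br) := by
  induction h using Relation.ReflTransGen.head_induction_on with
  | refl => exact ⟨c, hc, .refl, .refl⟩
  | @head e e₁ h _ ih =>
    by_cases he : IsCon t e
    · exact ⟨e, he, .refl, .refl⟩
    · obtain ⟨c', h₁, h₂, h₃⟩ := ih
      exact ⟨c', h₁, h₂.head h, h₃.head (.caseArg br he h)⟩

theorem noVal_caseD {t : S.T} {e : Term S} (br : Fin (S.ncon t) → Term S)
    (h : ∀ c, IsCon t c → ¬ Steps e c) : NoVal (.caseD t e br) := by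
  intro w hw hs
  generalize he : Term.caseD t e br = e' at hs
  induction hs using Relation.ReflTransGen.head_induction_on generalizing e with
  | refl =>
    subst he
    generalize he' : Term.caseD t e br = e' at hw
    have := congrArg Term.head he'
    cases hw <;> simp [Term.head] at this
  | head hs _ ih =>
    subst he
    cases hs with
    | caseD _ hl => exact h _ ⟨_, _, hl, rfl⟩ .refl
    | caseArg _ _ hs => exact ih (fun c hc hs' => h c hc (hs'.head hs)) rfl

theorem Steps.caseB_scrut {e e' : Term S} (e₁ e₂ : Term S) (h : Steps e e') :
    Steps (.caseB e e₁ e₂) (.caseB e' e₁ e₂) :=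
  h.map (F := (.caseB · e₁ e₂)) fun _ _ h => .caseBArg e₁ e₂ h

theorem noVal_caseB {e : Term S} (e₁ e₂ : Term S) (h : NoVal e) : NoVal (.caseB e e₁ e₂) := by
  intro w hw hs
  generalize he : Term.caseB e e₁ e₂ = e' at hs
  induction hs using Relation.ReflTransGen.head_induction_on generalizing e with
  | refl =>
    subst he
    generalize he' : Term.caseB e e₁ e₂ = e' at hw
    have := congrArg Term.head he'
    cases hw <;> simp [Term.head] at this
  | head hs _ ih =>
    subst he
    cases hs with
    | caseTrue => exact h _ (value_tBool _) .refl
    | caseFalse => exact h _ (value_tBool _) .refl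
    | caseBArg _ _ hs => exact ih (h.step hs) rfl

/-! ## Finite unrollings of fixpoints -/

/-- The `n`-th approximation of `fix f`: it diverges when it is unrolled more than `n` times. Every
unrolling takes exactly one step, as it does for `fix f`. -/
def approx : ℕ → Term S → Term S
  | 0, _ => tFix (.var 0)
  | n + 1, f => .app (.lam (.app (f.shift 1) ((approx n f).shift 1))) (tInt 0)

theorem approx_subst (n : ℕ) (f : Term S) (s : ℕ → Term S) :
    (approx n f).subst s = approx n (f.subst s) := by
  induction n with
  | zero => rfl
  | succ n ih => simp [approx, Term.subst, Term.subst_shift_upSub, ih, tInt]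

theorem approx_rename (n : ℕ) (f : Term S) (ρ : ℕ → ℕ) :
    (approx n f).rename ρ = approx n (f.rename ρ) := by
  rw [Term.rename_eq_subst, approx_subst, ← Term.rename_eq_subst]

theorem approx_succ_step (n : ℕ) (f : Term S) :
    Step (approx (n + 1) f) (.app f (approx n f)) := by
  have h := StepE.beta (E := fun σ₁ _ f g b => b = true ↔ ExtEq σ₁ f g)
    (.app (f.shift 1) ((approx n f).shift 1)) (tInt 0)
  have : (Term.app (f.shift 1) ((approx n f).shift 1)).inst (tInt 0) = .app f (approx n f) := by
    exact congrArg₂ Term.app (Term.shift_inst f _) (Term.shift_inst _ _)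
  rwa [this] at h

theorem approx_zero_step (f : Term S) :
    Step (approx 0 f) (.app (.lam (.var 0)) (approx 0 f)) := .fix _

theorem approx_zero_step' (f : Term S) :
    Step (.app (.lam (.var 0)) (approx 0 f)) (approx 0 f) := .beta (.var 0) _

theorem approx_head (n : ℕ) (f : Term S) :
    (approx n f).head = .cst .fix ∨ ∃ e, (approx n f).head = .lam e := by
  cases n with
  | zero => exact .inl rfl
  | succ n => exact .inr ⟨_, rfl⟩

theorem approx_eq_app (n : ℕ) (f : Term S) : ∃ g a, approx n f = .app g a := by
  cases n <;> exact ⟨_, _, rfl⟩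

theorem STyped.approx {f : Term S} {σ : STy S} (h : STyped [] f (.fn σ σ)) (n : ℕ) :
    STyped [] (approx n f) σ := by
  induction n with
  | zero => exact .app (.cst (.fix σ)) (.lam (.var rfl))
  | succ n ih => exact .app (.lam (.app (h.shift _) (ih.shift _))) (.cst (.int 0))

/-- `Cong k e e'`: the term `e'` arises from `e` by replacing some unrestricted fixpoints by
approximations of order at least `k`, and some approximations by higher ones. -/
inductive Cong : ℕ → Term S → Term S → Prop
  | var {k} (n : ℕ) : Cong k (.var n) (.var n)
  | cst {k} (c : Cst S) : Cong k (.cst c) (.cst c)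
  | lam {k e e'} : Cong k e e' → Cong k (.lam e) (.lam e')
  | app {k f f' a a'} : Cong k f f' → Cong k a a' → Cong k (.app f a) (.app f' a')
  | caseD {k t e e' br br'} : Cong k e e' → (∀ i, Cong k (br i) (br' i)) →
      Cong k (.caseD t e br) (.caseD t e' br')
  | caseB {k e e' e₁ e₁' e₂ e₂'} : Cong k e e' → Cong k e₁ e₁' → Cong k e₂ e₂' →
      Cong k (.caseB e e₁ e₂) (.caseB e' e₁' e₂')
  | letE {k b₁ b₁' b₂ b₂'} (τ τ' : RType S) : Cong k b₁ b₁' → Cong k b₂ b₂' →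
      Cong k (.letE τ b₁ b₂) (.letE τ' b₁' b₂')
  | reflect {k b₁ b₁' b₂ b₂'} (τ τ' : RType S) : Cong k b₁ b₁' → Cong k b₂ b₂' →
      Cong k (.reflect τ b₁ b₂) (.reflect τ' b₁' b₂')
  | fix {k f f' b} : Cong k f f' → k ≤ b → Cong k (.app (.cst .fix) f) (approx b f')
  | approx {k f f' a b} : Cong k f f' → a ≤ b → Cong k (approx a f) (approx b f')

theorem Cong.refl {k : ℕ} : (e : Term S) → Cong k e e
  | .var n => .var n
  | .cst c => .cst c
  | .lam e => .lam (.refl e)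
  | .app f a => .app (.refl f) (.refl a)
  | .caseD _ e br => .caseD (.refl e) fun i => .refl (br i)
  | .caseB e e₁ e₂ => .caseB (.refl e) (.refl e₁) (.refl e₂)
  | .letE τ b₁ b₂ => .letE τ τ (.refl b₁) (.refl b₂)
  | .reflect τ b₁ b₂ => .reflect τ τ (.refl b₁) (.refl b₂)

theorem Cong.mono {k k' : ℕ} {e e' : Term S} (h : Cong k e e') (hk : k' ≤ k) : Cong k' e e' := by
  induction h with
  | var n => exact .var n
  | cst c => exact .cst c
  | lam _ ih => exact .lam ih
  | app _ _ ih₁ ih₂ => exact .app ih₁ ih₂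
  | caseD _ _ ih₁ ih₂ => exact .caseD ih₁ fun i => ih₂ i
  | caseB _ _ _ ih ih₁ ih₂ => exact .caseB ih ih₁ ih₂
  | letE τ τ' _ _ ih₁ ih₂ => exact .letE τ τ' ih₁ ih₂
  | reflect τ τ' _ _ ih₁ ih₂ => exact .reflect τ τ' ih₁ ih₂
  | fix _ h ih => exact .fix ih (hk.trans h)
  | approx _ h ih => exact .approx ih h

theorem Cong.rename {k : ℕ} {e e' : Term S} (h : Cong k e e') (ρ : ℕ → ℕ) :
    Cong k (e.rename ρ) (e'.rename ρ) := by
  induction h generalizing ρ with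
  | var n => exact .var _
  | cst c => exact .cst c
  | lam _ ih => exact .lam (ih _)
  | app _ _ ih₁ ih₂ => exact .app (ih₁ _) (ih₂ _)
  | caseD _ _ ih₁ ih₂ => exact .caseD (ih₁ _) fun i => ih₂ i _
  | caseB _ _ _ ih ih₁ ih₂ => exact .caseB (ih _) (ih₁ _) (ih₂ _)
  | letE τ τ' _ _ ih₁ ih₂ => exact .letE _ _ (ih₁ _) (ih₂ _)
  | reflect τ τ' _ _ ih₁ ih₂ => exact .reflect _ _ (ih₁ _) (ih₂ _)
  | fix _ h ih => rw [approx_rename]; exact .fix (ih _) h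
  | approx _ h ih => rw [approx_rename, approx_rename]; exact .approx (ih _) h

theorem Cong.upSub {k : ℕ} {s s' : ℕ → Term S} (h : ∀ n, Cong k (s n) (s' n)) (n : ℕ) :
    Cong k (upSub s n) (upSub s' n) := by
  cases n with
  | zero => exact .var 0
  | succ n => exact (h n).rename _

theorem Cong.iterate_upSub {k : ℕ} {s s' : ℕ → Term S} (h : ∀ n, Cong k (s n) (s' n)) (j n : ℕ) :
    Cong k (Refl.upSub^[j] s n) (Refl.upSub^[j] s' n) := by
  induction j generalizing n with
  | zero => exact h n
  | succ j ih =>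
    rw [Function.iterate_succ_apply', Function.iterate_succ_apply']
    exact Cong.upSub ih n

theorem Cong.subst {k : ℕ} {e e' : Term S} (h : Cong k e e') {s s' : ℕ → Term S}
    (hs : ∀ n, Cong k (s n) (s' n)) : Cong k (e.subst s) (e'.subst s') := by
  induction h generalizing s s' with
  | var n => exact hs n
  | cst c => exact .cst c
  | lam _ ih => exact .lam (ih (.upSub hs))
  | app _ _ ih₁ ih₂ => exact .app (ih₁ hs) (ih₂ hs)
  | caseD _ _ ih₁ ih₂ => exact .caseD (ih₁ hs) fun i => ih₂ i (.iterate_upSub hs _)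
  | caseB _ _ _ ih ih₁ ih₂ => exact .caseB (ih hs) (ih₁ (.upSub hs)) (ih₂ (.upSub hs))
  | letE τ τ' _ _ ih₁ ih₂ => exact .letE _ _ (ih₁ (.upSub hs)) (ih₂ (.upSub hs))
  | reflect τ τ' _ _ ih₁ ih₂ => exact .reflect _ _ (ih₁ (.upSub hs)) (ih₂ (.upSub hs))
  | fix _ h ih => rw [approx_subst]; exact .fix (ih hs) h
  | approx _ h ih => rw [approx_subst, approx_subst]; exact .approx (ih hs) h

theorem Cong.subOf {k : ℕ} {as as' : List (Term S)} (h : List.Forall₂ (Cong k) as as') (n : ℕ) :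
    Cong k (subOf as n) (subOf as' n) := by
  induction h generalizing n with
  | nil => exact .refl _
  | cons h _ ih =>
    cases n with
    | zero => exact h
    | succ n => simpa using ih n

theorem Cong.inst {k : ℕ} {e e' a a' : Term S} (h : Cong k e e') (ha : Cong k a a') :
    Cong k (e.inst a) (e'.inst a') :=
  h.subst (.subOf (.cons ha .nil))

theorem Cong.apps {k : ℕ} {f f' : Term S} (h : Cong k f f') (as : List (Term S)) :
    Cong k (Term.apps f as) (Term.apps f' as) := by
  induction as generalizing f f' with
  | nil => exact h
  | cons a as ih => exact ih (.app h (.refl a))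

/-! ### Inversion -/

theorem Cong.cst_inv {k : ℕ} {c : Cst S} {e' : Term S} (h : Cong k (.cst c) e') : e' = .cst c := by
  generalize he : Term.cst c = e at h
  cases h with
  | cst => rfl
  | @approx f f' a b =>
    obtain ⟨_, _, h⟩ := approx_eq_app a f
    rw [h] at he; cases he
  | _ => cases he

theorem Cong.lam_inv {k : ℕ} {e e' : Term S} (h : Cong k (.lam e) e') :
    ∃ e₁, e' = .lam e₁ ∧ Cong k e e₁ := by
  generalize he : Term.lam e = e₀ at h
  cases h with
  | lam h => cases he; exact ⟨_, rfl, h⟩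
  | @approx f f' a b =>
    obtain ⟨_, _, h⟩ := approx_eq_app a f
    rw [h] at he; cases he
  | _ => cases he

/-- The terms at which `Cong` is not a congruence. -/
def CongFix (k : ℕ) (e e' : Term S) : Prop :=
  ∃ f f' b, Cong k f f' ∧ e' = approx b f' ∧
    (e = .app (.cst .fix) f ∧ k ≤ b ∨ ∃ a, e = approx a f ∧ a ≤ b)

theorem Cong.app_inv {k : ℕ} {f a e' : Term S} (h : Cong k (.app f a) e') :
    (∃ f' a', e' = .app f' a' ∧ Cong k f f' ∧ Cong k a a') ∨ CongFix k (.app f a) e' := by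
  generalize he : Term.app f a = e at h
  cases h with
  | app h₁ h₂ => cases he; exact .inl ⟨_, _, rfl, h₁, h₂⟩
  | fix h hb => exact .inr ⟨_, _, _, h, rfl, .inl ⟨rfl, hb⟩⟩
  | approx h hb => exact .inr ⟨_, _, _, h, rfl, .inr ⟨_, rfl, hb⟩⟩
  | _ => cases he

theorem CongFix.head_ne {k : ℕ} {c : Cst S} (hc : c ≠ .fix) {e e' : Term S}
    (h : CongFix k e e') : e.head ≠ .cst c ∧ e'.head ≠ .cst c := by
  have H : ∀ a (f : Term S), (approx a f).head ≠ .cst c := by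
    intro a f ha
    rcases approx_head a f with h | ⟨e, h⟩ <;> rw [h] at ha <;> cases ha
    exact hc rfl
  obtain ⟨f, f', b, -, rfl, ⟨rfl, -⟩ | ⟨a, rfl, -⟩⟩ := h
  · refine ⟨fun h => ?_, H _ _⟩
    cases h
    exact hc rfl
  · exact ⟨H _ _, H _ _⟩

theorem Cong.cst_apps_inv {k : ℕ} {c : Cst S} (hc : c ≠ .fix) {es : List (Term S)} {e' : Term S}
    (h : Cong k (Term.apps (.cst c) es) e') :
    ∃ es', e' = Term.apps (.cst c) es' ∧ List.Forall₂ (Cong k) es es' := by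
  induction es using List.reverseRecOn generalizing e' with
  | nil => exact ⟨[], h.cst_inv, .nil⟩
  | append_singleton es a ih =>
    rw [Term.apps_concat] at h
    rcases h.app_inv with ⟨f', a', rfl, hf, ha⟩ | h
    · obtain ⟨es', rfl, hes⟩ := ih hf
      exact ⟨es' ++ [a'], by simp, List.rel_append hes (.cons ha .nil)⟩
    · exact absurd (by simp [Term.head]) (h.head_ne hc).1

theorem Cong.cst_apps_inv_right {k : ℕ} {c : Cst S} (hc : c ≠ .fix) {es' : List (Term S)}
    {e : Term S} (h : Cong k e (Term.apps (.cst c) es')) :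
    ∃ es, e = Term.apps (.cst c) es ∧ List.Forall₂ (Cong k) es es' := by
  have hh : (Term.apps (.cst c) es').head = .cst c := by simp [Term.head]
  induction es' using List.reverseRecOn generalizing e with
  | nil =>
    generalize he : Term.apps (.cst c) [] = e' at h hh
    cases h with
    | cst => exact ⟨[], he.symm, .nil⟩
    | fix h hb => exact absurd hh (CongFix.head_ne hc ⟨_, _, _, h, rfl, .inl ⟨rfl, hb⟩⟩).2
    | approx h hb => exact absurd hh (CongFix.head_ne hc ⟨_, _, _, h, rfl, .inr ⟨_, rfl, hb⟩⟩).2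
    | _ => cases he
  | append_singleton es' a' ih =>
    generalize he : Term.apps (.cst c) (es' ++ [a']) = e' at h hh
    rw [Term.apps_concat] at he
    cases h with
    | app h₁ h₂ =>
      cases he
      obtain ⟨es, rfl, hes⟩ := ih h₁ (by simp [Term.head])
      exact ⟨es ++ [_], by simp, List.rel_append hes (.cons h₂ .nil)⟩
    | fix h hb => exact absurd hh (CongFix.head_ne hc ⟨_, _, _, h, rfl, .inl ⟨rfl, hb⟩⟩).2
    | approx h hb => exact absurd hh (CongFix.head_ne hc ⟨_, _, _, h, rfl, .inr ⟨_, rfl, hb⟩⟩).2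
    | _ => cases he

theorem Cong.isCon {k : ℕ} {t : S.T} {e e' : Term S} (h : Cong k e e') (h' : IsCon t e') :
    IsCon t e := by
  obtain ⟨i, es', hl, rfl⟩ := h'
  obtain ⟨es, rfl, hes⟩ := h.cst_apps_inv_right (by simp)
  exact ⟨i, es, by rw [hes.length_eq, hl], rfl⟩

theorem Cong.caseD_inv {k : ℕ} {t : S.T} {e e' : Term S} {br : Fin (S.ncon t) → Term S}
    (h : Cong k (.caseD t e br) e') :
    ∃ e₁ br', e' = .caseD t e₁ br' ∧ Cong k e e₁ ∧ ∀ i, Cong k (br i) (br' i) := by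
  generalize he : Term.caseD t e br = e₀ at h
  cases h with
  | caseD h h' => cases he; exact ⟨_, _, rfl, h, h'⟩
  | @approx f f' a b =>
    obtain ⟨_, _, h⟩ := approx_eq_app a f
    rw [h] at he; cases he
  | _ => cases he

theorem Cong.caseB_inv {k : ℕ} {e e₁ e₂ e' : Term S} (h : Cong k (.caseB e e₁ e₂) e') :
    ∃ e₀ e₁' e₂', e' = .caseB e₀ e₁' e₂' ∧ Cong k e e₀ ∧ Cong k e₁ e₁' ∧ Cong k e₂ e₂' := by
  generalize he : Term.caseB e e₁ e₂ = e₀ at h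
  cases h with
  | caseB h h₁ h₂ => cases he; exact ⟨_, _, _, rfl, h, h₁, h₂⟩
  | @approx f f' a b =>
    obtain ⟨_, _, h⟩ := approx_eq_app a f
    rw [h] at he; cases he
  | _ => cases he

theorem Cong.letE_inv {k : ℕ} {τ : RType S} {b₁ b₂ e' : Term S} (h : Cong k (.letE τ b₁ b₂) e') :
    ∃ τ' b₁' b₂', e' = .letE τ' b₁' b₂' ∧ Cong k b₁ b₁' ∧ Cong k b₂ b₂' := by
  generalize he : Term.letE τ b₁ b₂ = e₀ at h
  cases h with
  | letE _ _ h₁ h₂ => cases he; exact ⟨_, _, _, rfl, h₁, h₂⟩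
  | @approx f f' a b =>
    obtain ⟨_, _, h⟩ := approx_eq_app a f
    rw [h] at he; cases he
  | _ => cases he

theorem Cong.reflect_inv {k : ℕ} {τ : RType S} {b₁ b₂ e' : Term S}
    (h : Cong k (.reflect τ b₁ b₂) e') :
    ∃ τ' b₁' b₂', e' = .reflect τ' b₁' b₂' ∧ Cong k b₁ b₁' ∧ Cong k b₂ b₂' := by
  generalize he : Term.reflect τ b₁ b₂ = e₀ at h
  cases h with
  | reflect _ _ h₁ h₂ => cases he; exact ⟨_, _, _, rfl, h₁, h₂⟩
  | @approx f f' a b =>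
    obtain ⟨_, _, h⟩ := approx_eq_app a f
    rw [h] at he; cases he
  | _ => cases he

theorem Cong.ground_eq {k : ℕ} {w e' : Term S} (hw : Ground w) (h : Cong k w e') : e' = w := by
  induction hw generalizing e' with
  | int n => exact h.cst_inv
  | bool b => exact h.cst_inv
  | con t i ws _ ih =>
    obtain ⟨ws', rfl, hws⟩ := h.cst_apps_inv (by simp)
    congr 1
    clear h
    induction hws with
    | nil => rfl
    | cons h _ ih' =>
      rw [ih _ (by simp) h, ih' (fun w hw => by simp_all) (fun w hw => ih w (by simp [hw]))]

/-! ### Simulation -/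

theorem CongFix.step {k : ℕ} {e e' e₁ : Term S} (h : CongFix (k + 1) e e') (hs : Step e e₁) :
    (∃ e₁', Step e' e₁' ∧ Cong k e₁ e₁') ∨ Step e₁ e := by
  obtain ⟨f, f', b, h, rfl, ⟨rfl, hb⟩ | ⟨a, rfl, hab⟩⟩ := h
  · obtain rfl := hs.det (.fix f)
    obtain ⟨b, rfl⟩ : ∃ b', b = b' + 1 := ⟨b - 1, by omega⟩
    have h := h.mono (Nat.le_succ k)
    exact .inl ⟨_, approx_succ_step _ _, .app h (.fix h (by omega))⟩
  · cases a with
    | zero =>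
      obtain rfl := hs.det (approx_zero_step f)
      exact .inr (approx_zero_step' f)
    | succ a =>
      obtain rfl := hs.det (approx_succ_step a f)
      obtain ⟨b, rfl⟩ : ∃ b', b = b' + 1 := ⟨b - 1, by omega⟩
      have h := h.mono (Nat.le_succ k)
      exact .inl ⟨_, approx_succ_step _ _, .app h (.approx h (by omega))⟩

theorem STyped.strict_arg {c : Cst S} (hc : c.Strict) {a : Term S} {σ : STy S}
    (h : STyped [] (.app (.cst c) a) σ) : ∃ b, STyped [] a (.base b) := by
  cases h with
  | app h ha => cases h with
    | cst h =>
      generalize hσ : STy.fn _ σ = σ' at h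
      cases h <;> first
        | (cases hσ; exact ⟨_, ha⟩)
        | exact hc.elim

theorem STyped.strict_arg₂ {c : Cst S} (hc : c.Strict₂) {a b : Term S} {σ : STy S}
    (h : STyped [] (.app (.app (.cst c) a) b) σ) : ∃ b', STyped [] b (.base b') := by
  cases h with
  | app h hb => cases h with
    | app h _ => cases h with
      | cst h =>
        generalize hσ : STy.fn _ (STy.fn _ σ) = σ' at h
        cases h <;> first
          | (cases hσ; exact ⟨_, hb⟩)
          | exact hc.elim

theorem STyped.con_args_base {t : S.T} {i : Fin (S.ncon t)} {es : List (Term S)} {σ : STy S}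
    (h : STyped [] (Term.apps (.cst (.con t i)) es) σ) :
    ∀ e ∈ es, ∃ b, STyped [] e (.base b) := by
  obtain ⟨bs, -, -, -, h⟩ := h.con_apps_inv
  intro e he
  rename_i h₀
  clear h₀
  induction es generalizing bs with
  | nil => simp at he
  | cons e' es ih =>
    cases bs with
    | nil => cases h
    | cons b bs =>
      cases h with
      | cons h h' =>
        rcases List.mem_cons.1 he with rfl | he
        · exact ⟨b, h⟩
        · exact ih bs h' he

theorem Cong.step {k : ℕ} {e e' e₁ : Term S} {σ : STy S} (h : Cong (k + 1) e e')
    (ht : STyped [] e σ) (hs : Step e e₁) :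
    (∃ e₁', Step e' e₁' ∧ Cong k e₁ e₁') ∨ Step e₁ e := by
  have hs₀ := hs
  induction hs generalizing e' σ with
  | beta e a =>
    rcases h.app_inv with ⟨f', a', rfl, hf, ha⟩ | h
    · obtain ⟨b', rfl, hb⟩ := hf.lam_inv
      exact .inl ⟨_, .beta _ _, (hb.inst ha).mono (Nat.le_succ k)⟩
    · exact h.step hs₀
  | appL a hs ih =>
    rcases h.app_inv with ⟨f', a', rfl, hf, ha⟩ | h
    · cases ht with
      | app ht _ =>
        rcases ih hf ht hs with ⟨f₁, h₁, h₂⟩ | h₁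
        · exact .inl ⟨_, .appL _ h₁, .app h₂ (ha.mono (Nat.le_succ k))⟩
        · exact .inr (.appL _ h₁)
    · exact h.step hs₀
  | @primArg c a a₁ hc hs ih =>
    obtain ⟨_, rfl, hes⟩ := Cong.cst_apps_inv (es := [a]) (by rintro rfl; exact hc) h
    obtain ⟨b, ht⟩ := ht.strict_arg hc
    cases hes with
    | cons ha hes =>
      cases hes
      rcases ih ha ht hs with ⟨f₁, h₁, h₂⟩ | h₁
      · exact .inl ⟨_, .primArg hc h₁, .app (.cst c) h₂⟩
      · exact .inr (.primArg hc h₁)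
  | @primArg₂ c w a a₁ hc hw hs ih =>
    obtain ⟨_, rfl, hes⟩ := Cong.cst_apps_inv (es := [w, a]) (by rintro rfl; exact hc) h
    have htw : ∃ b, STyped [] w (.base b) := by
      cases ht with | app ht _ => exact ht.strict_arg hc.strict
    obtain ⟨b, htw⟩ := htw
    obtain ⟨b, hta⟩ := ht.strict_arg₂ hc
    cases hes with
    | cons hw' hes => cases hes with
      | cons ha hes =>
        cases hes
        obtain rfl := Cong.ground_eq (hw.ground htw) hw'
        rcases ih ha hta hs with ⟨f₁, h₁, h₂⟩ | h₁
        · exact .inl ⟨_, .primArg₂ hc hw h₁, .app (.refl _) h₂⟩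
        · exact .inr (.primArg₂ hc hw h₁)
  | @conArg t i ws a a₁ hl hv hs ih =>
    rw [← Term.apps_concat] at ht h
    have hta := ht.con_args_base
    obtain ⟨b, ht⟩ := hta a (by simp)
    rw [Term.apps_concat] at h
    rcases h.app_inv with ⟨f', a', rfl, hf, ha⟩ | h
    · have hg : Ground (Term.apps (.cst (.con t i)) ws) := by
        refine .con t i ws fun w hw => ?_
        obtain ⟨b, hb⟩ := hta w (by simp [hw])
        exact (hv w hw).ground hb
      obtain rfl := hf.ground_eq hg
      rcases ih ha ht hs with ⟨f₁, h₁, h₂⟩ | h₁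
      · exact .inl ⟨_, .conArg hl hv h₁, .app (.refl _) h₂⟩
      · exact .inr (.conArg hl hv h₁)
    · exact h.step hs₀
  | not b =>
    obtain ⟨_, rfl, hes⟩ := Cong.cst_apps_inv (es := [tBool b]) (by simp) h
    cases hes with
    | cons ha hes =>
      cases hes
      obtain rfl := ha.cst_inv
      exact .inl ⟨_, .not b, .refl _⟩
  | @bin o c₁ c₂ c hc =>
    obtain ⟨_, rfl, hes⟩ := Cong.cst_apps_inv (es := [.cst c₁, .cst c₂]) (by simp) h
    cases hes with
    | cons ha hes => cases hes with
      | cons hb hes =>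
        cases hes
        obtain rfl := ha.cst_inv
        obtain rfl := hb.cst_inv
        exact .inl ⟨_, .bin hc, .refl _⟩
  | @eqTrue b w hw =>
    obtain ⟨_, rfl, hes⟩ := Cong.cst_apps_inv (es := [w, w]) (by simp) h
    obtain ⟨b', ht⟩ := STyped.strict_arg₂ (c := .eq (.base b)) trivial ht
    cases hes with
    | cons ha hes => cases hes with
      | cons hb hes =>
        cases hes
        obtain rfl := ha.ground_eq (hw.ground ht)
        obtain rfl := hb.ground_eq (hw.ground ht)
        exact .inl ⟨_, .eqTrue hw, .refl _⟩
  | @eqFalse b w₁ w₂ hw₁ hw₂ hne =>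
    obtain ⟨_, rfl, hes⟩ := Cong.cst_apps_inv (es := [w₁, w₂]) (by simp) h
    have ht₁ : ∃ b, STyped [] w₁ (.base b) := by
      cases ht with | app ht _ => exact ht.strict_arg (c := .eq (.base b)) trivial
    obtain ⟨_, ht₁⟩ := ht₁
    obtain ⟨_, ht₂⟩ := STyped.strict_arg₂ (c := .eq (.base b)) trivial ht
    cases hes with
    | cons ha hes => cases hes with
      | cons hb hes =>
        cases hes
        obtain rfl := ha.ground_eq (hw₁.ground ht₁)
        obtain rfl := hb.ground_eq (hw₂.ground ht₂)
        exact .inl ⟨_, .eqFalse hw₁ hw₂ hne, .refl _⟩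
  | eqFun =>
    cases ht with
    | app ht _ => cases ht with | app ht _ => exact absurd ht STyped.not_eq_fn
  | @size t w hw =>
    obtain ⟨_, rfl, hes⟩ := Cong.cst_apps_inv (es := [w]) (by simp) h
    obtain ⟨b, ht⟩ := STyped.strict_arg (c := .size t) trivial ht
    cases hes with
    | cons ha hes =>
      cases hes
      obtain rfl := ha.ground_eq (hw.ground ht)
      exact .inl ⟨_, .size hw, .refl _⟩
  | fix f =>
    rcases h.app_inv with ⟨f', a', rfl, hf, ha⟩ | h
    · obtain rfl := hf.cst_inv
      have ha := ha.mono (Nat.le_succ k)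
      exact .inl ⟨_, .fix _, .app ha (.app (.refl _) ha)⟩
    · exact h.step hs₀
  | @caseD t i es br hl =>
    obtain ⟨e₁, br', rfl, h₁, h₂⟩ := h.caseD_inv
    obtain ⟨es', rfl, hes⟩ := h₁.cst_apps_inv (by simp)
    exact .inl ⟨_, .caseD _ (by rw [← hes.length_eq, hl]),
      ((h₂ i).subst (.subOf (by exact .cons h₁ hes))).mono (Nat.le_succ k)⟩
  | caseArg br hn hs ih =>
    obtain ⟨e₁, br', rfl, h₁, h₂⟩ := h.caseD_inv
    cases ht with
    | caseD ht _ =>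
      rcases ih h₁ ht hs with ⟨f₁, h₃, h₄⟩ | h₃
      · exact .inl ⟨_, .caseArg _ (fun h => hn (h₁.isCon h)) h₃,
          .caseD h₄ fun i => (h₂ i).mono (Nat.le_succ k)⟩
      · exact .inr (.caseArg _ (fun h => hn (h.step h₃)) h₃)
  | caseTrue =>
    obtain ⟨e₀, e₁', e₂', rfl, h₀, h₁, h₂⟩ := h.caseB_inv
    obtain rfl := h₀.cst_inv
    exact .inl ⟨_, .caseTrue _ _, (h₁.inst (.refl _)).mono (Nat.le_succ k)⟩
  | caseFalse =>
    obtain ⟨e₀, e₁', e₂', rfl, h₀, h₁, h₂⟩ := h.caseB_inv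
    obtain rfl := h₀.cst_inv
    exact .inl ⟨_, .caseFalse _ _, (h₂.inst (.refl _)).mono (Nat.le_succ k)⟩
  | caseBArg e₁ e₂ hs ih =>
    obtain ⟨e₀, e₁', e₂', rfl, h₀, h₁, h₂⟩ := h.caseB_inv
    cases ht with
    | caseB ht _ _ =>
      rcases ih h₀ ht hs with ⟨f₁, h₃, h₄⟩ | h₃
      · exact .inl ⟨_, .caseBArg _ _ h₃,
          .caseB h₄ (h₁.mono (Nat.le_succ k)) (h₂.mono (Nat.le_succ k))⟩
      · exact .inr (.caseBArg _ _ h₃)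
  | letE τ b₁ b₂ =>
    obtain ⟨τ', b₁', b₂', rfl, h₁, h₂⟩ := h.letE_inv
    exact .inl ⟨_, .letE _ _ _,
      (h₂.inst (.app (.cst _) (.lam h₁))).mono (Nat.le_succ k)⟩
  | reflect τ b₁ b₂ =>
    obtain ⟨τ', b₁', b₂', rfl, h₁, h₂⟩ := h.reflect_inv
    exact .inl ⟨_, .reflect _ _ _, (Cong.letE _ _ h₁ h₂).mono (Nat.le_succ k)⟩

/-- Evaluation in a given number of steps. -/
inductive StepsN : ℕ → Term S → Term S → Prop
  | refl (e) : StepsN 0 e e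
  | head {n e e' w} : Step e e' → StepsN n e' w → StepsN (n + 1) e w

theorem Steps.exists_stepsN {e w : Term S} (h : Steps e w) : ∃ n, StepsN n e w := by
  induction h using Relation.ReflTransGen.head_induction_on with
  | refl => exact ⟨0, .refl _⟩
  | head h _ ih => exact ih.imp' _ fun n hn => .head h hn

theorem Cong.stepsN {n k : ℕ} {e e' w : Term S} {b : Base S.T} (hk : n ≤ k) (h : Cong k e e')
    (ht : STyped [] e (.base b)) (hs : StepsN n e w) (hw : Value w) : Steps e' w := by
  induction n using Nat.strong_induction_on generalizing k e e' with
  | _ n IH =>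
    cases hs with
    | refl =>
      rw [h.ground_eq (hw.ground ht)]
      exact .refl
    | @head n _ e₁ _ hs hs' =>
      obtain ⟨k, rfl⟩ : ∃ k', k = k' + 1 := ⟨k - 1, by omega⟩
      rcases h.step ht hs with ⟨e₁', h₁, h₂⟩ | h₁
      · exact (IH n (by omega) (by omega) h₂ (ht.step hs) hs').head h₁
      · cases hs' with
        | refl => exact absurd h₁ hw.not_step
        | @head n _ e₂ _ hs₂ hs' =>
          obtain rfl := h₁.det hs₂
          exact IH n (by omega) (by omega) h ht hs'

/-- A result at a basic type depends on finitely many unrollings only. -/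
theorem Steps.exists_approx {f w : Term S} {as : List (Term S)} {b : Base S.T}
    (ht : STyped [] (Term.apps (.app (.cst .fix) f) as) (.base b))
    (h : Steps (Term.apps (.app (.cst .fix) f) as) w) (hw : Value w) :
    ∃ n, Steps (Term.apps (approx n f) as) w := by
  obtain ⟨n, hn⟩ := h.exists_stepsN
  exact ⟨n, Cong.stepsN le_rfl (.apps (.fix (.refl f) le_rfl) as) ht hn hw⟩

theorem Steps.approx_mono {e f w : Term S} {as : List (Term S)} {b : Base S.T} {m n : ℕ}
    (hmn : m ≤ n) (ht : STyped [] (Term.apps (e.inst (approx m f)) as) (.base b))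
    (h : Steps (Term.apps (e.inst (approx m f)) as) w) (hw : Value w) :
    Steps (Term.apps (e.inst (approx n f)) as) w := by
  obtain ⟨k, hk⟩ := h.exists_stepsN
  exact Cong.stepsN le_rfl
    (.apps (.inst (.refl e) (.approx (.refl f) hmn)) as) ht hk hw

theorem noVal_approx_zero (f : Term S) : NoVal (approx 0 f) := by
  intro w hw hs
  obtain ⟨n, hn⟩ := hs.exists_stepsN
  induction n using Nat.strong_induction_on with
  | _ n IH =>
    generalize he : approx 0 f = e at hn
    cases hn with
    | refl => subst he; exact hw.not_step (approx_zero_step f)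
    | head h₁ hn =>
      subst he
      obtain rfl := h₁.det (approx_zero_step f)
      generalize he : Term.app (Term.lam (Term.var 0)) (approx 0 f) = e at hn
      cases hn with
      | refl => subst he; exact hw.not_step (approx_zero_step' f)
      | head h₂ hn =>
        subst he
        obtain rfl := h₂.det (approx_zero_step' f)
        exact IH _ (by omega) hn

/-! ## Denotations -/

/-- `e` evaluates to a value. -/
def Terminates (e : Term S) : Prop := ∃ w, Value w ∧ Steps e w

theorem RType.inst_induction {P : RType S → Prop} (base : ∀ b l r, P (.base b l r))
    (fn : ∀ τ₁ τ₂, P τ₁ → (∀ a, P (τ₂.inst a)) → P (.fn τ₁ τ₂)) (τ : RType S) : P τ := by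
  suffices H : ∀ (σ : STy S) (τ : RType S), τ.erase = σ → P τ from H _ τ rfl
  intro σ
  induction σ with
  | base b =>
    intro τ hτ
    cases τ with
    | base => exact base _ _ _
    | fn => cases hτ
  | fn σ₁ σ₂ ih₁ ih₂ =>
    intro τ hτ
    cases τ with
    | base => cases hτ
    | fn τ₁ τ₂ =>
      simp only [RType.erase, STy.fn.injEq] at hτ
      exact fn _ _ (ih₁ _ hτ.1) fun a => ih₂ _ (by simp [hτ.2])

theorem mem_den_base {b : Base S.T} {l : Label} {r e : Term S} :
    e ∈ (RType.base b l r).den ↔ STyped [] e (.base b) ∧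
      (∀ w, Value w → Steps e w → Steps (r.inst w) (tBool true)) ∧ (l = .tot → Terminates e) :=
  Iff.rfl

theorem mem_den_fn {τ₁ τ₂ : RType S} {e : Term S} :
    e ∈ (RType.fn τ₁ τ₂).den ↔ STyped [] e (.fn τ₁.erase τ₂.erase) ∧
      ∀ a ∈ τ₁.den, .app e a ∈ (τ₂.inst a).den := by
  simp only [RType.den, Set.mem_ofPred_eq, RType.erase_inst]
  rfl

theorem styped_of_mem_den {τ : RType S} {e : Term S} (h : e ∈ τ.den) : STyped [] e τ.erase := by
  cases τ with
  | base => exact (mem_den_base.1 h).1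
  | fn => exact (mem_den_fn.1 h).1

theorem mem_den_of_steps {τ : RType S} {e e' : Term S} (hs : Steps e e')
    (ht : STyped [] e τ.erase) (h : e' ∈ τ.den) : e ∈ τ.den := by
  induction τ using RType.inst_induction generalizing e e' with
  | base b l r =>
    rw [mem_den_base] at h ⊢
    refine ⟨ht, fun w hw hs' => h.2.1 w hw (hs.of_steps_value hs' hw), fun hl => ?_⟩
    obtain ⟨w, hw, hs'⟩ := h.2.2 hl
    exact ⟨w, hw, hs.trans hs'⟩
  | fn τ₁ τ₂ ih₁ ih₂ =>
    rw [mem_den_fn] at h ⊢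
    refine ⟨ht, fun a ha => ih₂ a (hs.appL a) ?_ (h.2 a ha)⟩
    rw [RType.erase_inst]
    exact .app ht (styped_of_mem_den ha)

theorem mem_den_base_of_steps {b : Base S.T} {l : Label} {r e e' : Term S}
    (h : e ∈ (RType.base b l r).den) (hs : Steps e e') : e' ∈ (RType.base b l r).den := by
  rw [mem_den_base] at h ⊢
  refine ⟨h.1.steps hs, fun w hw hs' => h.2.1 w hw (hs.trans hs'), fun hl => ?_⟩
  obtain ⟨w, hw, hs'⟩ := h.2.2 hl
  exact ⟨w, hw, hs.of_steps_value hs' hw⟩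

@[simp] theorem RType.mayDiverge_inst (τ : RType S) (a : Term S) :
    (τ.inst a).MayDiverge ↔ τ.MayDiverge := RType.mayDiverge_subst _ _

@[simp] theorem RType.mayDiverge_shift (τ : RType S) (k : ℕ) :
    (τ.shift k).MayDiverge ↔ τ.MayDiverge := by
  rw [RType.shift, RType.rename_eq_subst, RType.mayDiverge_subst]

theorem mem_den_of_noVal {τ : RType S} {e : Term S} (hτ : τ.MayDiverge)
    (ht : STyped [] e τ.erase) (h : NoVal e) : e ∈ τ.den := by
  induction τ using RType.inst_induction generalizing e with
  | base b l r =>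
    rw [mem_den_base]
    refine ⟨ht, fun w hw hs => absurd hs (h w hw), fun hl => ?_⟩
    cases hτ.symm.trans hl
  | fn τ₁ τ₂ ih₁ ih₂ =>
    rw [mem_den_fn]
    refine ⟨ht, fun a ha => ih₂ a ((τ₂.mayDiverge_inst a).2 hτ) ?_ (h.app a)⟩
    rw [RType.erase_inst]
    exact .app ht (styped_of_mem_den ha)

/-- Denotations of types without a termination mark are closed under limits of approximations. -/
theorem mem_den_of_approx {τ : RType S} {e : Term S} {g : ℕ → Term S} (hτ : τ.MayDiverge)
    (ht : STyped [] e τ.erase) (hg : ∀ n, g n ∈ τ.den)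
    (h : ∀ as b w, STyped [] (Term.apps e as) (.base b) → Value w → Steps (Term.apps e as) w →
      ∃ n, Steps (Term.apps (g n) as) w) : e ∈ τ.den := by
  induction τ using RType.inst_induction generalizing e g with
  | base b l r =>
    rw [mem_den_base]
    refine ⟨ht, fun w hw hs => ?_, fun hl => ?_⟩
    · obtain ⟨n, hn⟩ := h [] b w ht hw hs
      exact (mem_den_base.1 (hg n)).2.1 w hw hn
    · cases hτ.symm.trans hl
  | fn τ₁ τ₂ ih₁ ih₂ =>
    rw [mem_den_fn]
    refine ⟨ht, fun a ha => ih₂ a (g := fun n => .app (g n) a)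
      ((τ₂.mayDiverge_inst a).2 hτ) ?_
      (fun n => (mem_den_fn.1 (hg n)).2 a ha) fun as => h (a :: as)⟩
    rw [RType.erase_inst]
    exact .app ht (styped_of_mem_den ha)

theorem fix_mem_den {τ : RType S} {f : Term S} (hτ : τ.MayDiverge)
    (ht : STyped [] f (.fn τ.erase τ.erase)) (h : ∀ n, approx n f ∈ τ.den) :
    .app (.cst .fix) f ∈ τ.den :=
  mem_den_of_approx hτ (.app (.cst (.fix _)) ht) h fun _ _ _ ht hw hs => hs.exists_approx ht hw

/-! ### Reflection -/

/-- Every result of `h` at a basic type is a result of `e`. -/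
def ObsLe (h e : Term S) : Prop :=
  ∀ as b w, STyped [] (Term.apps h as) (.base b) → Value w → Steps (Term.apps h as) w →
    Steps (Term.apps e as) w

theorem tEq_var_inst (b : Base S.T) (e w : Term S) :
    (tEq b (.var 0) (e.shift 1)).inst w = tEq b w e :=
  congrArg (tEq b w) (Term.shift_inst e w)

theorem Reflects.subst {τ e τ' : _} (h : Reflects (S := S) τ e τ') (s : ℕ → Term S) :
    Reflects (τ.subst s) (e.subst s) (τ'.subst s) := by
  induction h generalizing s with
  | base b l r e =>
    have := Reflects.base b l (r.subst (upSub s)) (e.subst s)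
    rwa [← Term.subst_shift_upSub] at this
  | fn _ ih => exact .fn (ih _)

theorem Reflects.erase_eq {τ e τ' : _} (h : Reflects (S := S) τ e τ') : τ'.erase = τ.erase := by
  induction h with
  | base => rfl
  | fn _ ih => simp [RType.erase, ih]

theorem Reflects.mayDiverge_iff {τ e τ' : _} (h : Reflects (S := S) τ e τ') :
    τ'.MayDiverge ↔ τ.MayDiverge := by
  induction h with
  | base => rfl
  | fn _ ih => exact ih

theorem Reflects.mem_of_mem {τ e τ' : _} (h : Reflects (S := S) τ e τ') {f : Term S}
    (hf : f ∈ τ'.den) : f ∈ τ.den := by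
  induction τ using RType.inst_induction generalizing e τ' f with
  | base b l r =>
    cases h
    rw [mem_den_base] at hf ⊢
    exact ⟨hf.1, fun w hw hs => (Steps.of_conj (hf.2.1 w hw hs)).1, hf.2.2⟩
  | fn τ₁ τ₂ ih₁ ih₂ =>
    cases h with
    | fn h =>
      rw [mem_den_fn] at hf ⊢
      rw [h.erase_eq] at hf
      exact ⟨hf.1, fun a ha => ih₂ a (h.subst _) (hf.2 a ha)⟩

theorem Reflects.mem {τ e τ' : _} (h : Reflects (S := S) τ e τ') {f : Term S}
    (hf : f ∈ τ.den) (hfe : ObsLe f e) : f ∈ τ'.den := by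
  induction τ using RType.inst_induction generalizing e τ' f with
  | base b l r =>
    cases h
    rw [mem_den_base] at hf ⊢
    refine ⟨hf.1, fun w hw hs => Steps.conj (hf.2.1 w hw hs) ?_, hf.2.2⟩
    change Steps ((tEq b (.var 0) (e.shift 1)).inst w) _
    rw [tEq_var_inst]
    exact Steps.tEq hw .refl (hfe [] b w hf.1 hw hs)
  | fn τ₁ τ₂ ih₁ ih₂ =>
    cases h with
    | @fn _ _ e _ h =>
      rw [mem_den_fn] at hf ⊢
      rw [h.erase_eq]
      refine ⟨hf.1, fun a ha => ih₂ a (h.subst _) (hf.2 a ha) fun as b w ht hw hs => ?_⟩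
      exact Steps.of_steps_value (.apps (.single (.beta e a)) as) (hfe (a :: as) b w ht hw hs) hw

/-! ### Environments -/

/-- Erasure of an environment. -/
def Env.erase (Γ : Env S) : List (STy S) := Γ.map RType.erase

@[simp] theorem Env.erase_ext (Γ : Env S) (τ : RType S) : (Γ.ext τ).erase = τ.erase :: Γ.erase := by
  simp [Env.erase, Env.ext]

theorem Env.den_cons {Γ : Env S} {τ : RType S} {θ : List (Term S)} {a : Term S} (hθ : θ ∈ Γ.den)
    (ha : a ∈ (τ.subst (subOf (a :: θ))).den) : (a :: θ) ∈ Env.den (τ :: Γ) := by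
  refine ⟨by simpa using hθ.1, fun i τ' hi => ?_⟩
  cases i with
  | zero =>
    obtain rfl : τ = τ' := by simpa using hi
    rwa [RType.shift_zero]
  | succ i =>
    have h := hθ.2 i τ' (by simpa using hi)
    rw [subOf_cons_succ]
    have : τ'.shift (i + 1) = (τ'.shift i).shift 1 := by
      simp [RType.shift, RType.rename_rename, Nat.add_assoc]
    rwa [this, RType.shift_subst_cons]

theorem Env.den_ext {Γ : Env S} {τ : RType S} {θ : List (Term S)} {a : Term S} (hθ : θ ∈ Γ.den)
    (ha : a ∈ (τ.subst (subOf θ)).den) : (a :: θ) ∈ (Γ.ext τ).den :=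
  Env.den_cons hθ (by rwa [RType.shift_subst_cons])

theorem Env.styped_subst {Γ : Env S} {θ : List (Term S)} (hθ : θ ∈ Γ.den) {e : Term S} {σ : STy S}
    (h : STyped Γ.erase e σ) : STyped [] (e.subst (subOf θ)) σ := by
  refine h.subst fun i σ hi => ?_
  simp only [Env.erase, List.getElem?_map, Option.map_eq_some_iff] at hi
  obtain ⟨τ, hi, rfl⟩ := hi
  simpa using styped_of_mem_den (hθ.2 i τ hi)

theorem mem_den_triv {b : Base S.T} {l : Label} {e : Term S} :
    e ∈ (triv b l : RType S).den ↔ STyped [] e (.base b) ∧ (l = .tot → Terminates e) := by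
  rw [triv, mem_den_base]
  exact ⟨fun h => ⟨h.1, h.2.2⟩, fun h => ⟨h.1, fun _ _ _ => .refl, h.2⟩⟩

theorem Env.den_triv_append {Γ : Env S} {θ es : List (Term S)} {bs : List (Base S.T)} {l : Label}
    (hθ : θ ∈ Γ.den) (h : List.Forall₂ (fun e b => e ∈ (triv b l : RType S).den) es bs) :
    (es ++ θ) ∈ Env.den (bs.map (fun b => triv b l) ++ Γ) := by
  induction h with
  | nil => exact hθ
  | cons h _ ih => exact Env.den_cons ih h

/-! ## Semantic typing -/

/-- The semantic counterpart of `Γ ⊢ p : τ`. -/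
def SemTy (Γ : Env S) (p : Term S) (τ : RType S) : Prop :=
  STyped Γ.erase p τ.erase ∧ ∀ θ ∈ Γ.den, p.subst (subOf θ) ∈ (τ.subst (subOf θ)).den

/-- The semantic counterpart of a definition `x = b` that checks at `τ`, for the types `τ` that
occur in `let rec` and in `reflect`. -/
def SemDef (Γ : Env S) (τ : RType S) (b : Term S) : Prop :=
  STyped (τ.erase :: Γ.erase) b τ.erase ∧
    ∀ τ₀ : RType S, (τ = τ₀.shift 1 ∨ Reflects (τ₀.shift 1) b τ) → ∀ θ ∈ Γ.den,
      (tFix b).subst (subOf θ) ∈ (τ.subst (subOf ((tFix b).subst (subOf θ) :: θ))).den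

theorem SemTy.var {Γ : Env S} {i : ℕ} {τ : RType S} (h : Γ[i]? = some τ) :
    SemTy Γ (.var i) (τ.shift i) :=
  ⟨.var (by simp [Env.erase, h]), fun _ hθ => hθ.2 i τ h⟩

theorem SemTy.fix {Γ : Env S} {τ : RType S} (hτ : τ.MayDiverge) :
    SemTy Γ (.cst .fix) (.fn (.fn τ (τ.shift 1)) (τ.shift 1)) := by
  have ht : ∀ Δ, STyped Δ (.cst .fix) (RType.fn (.fn τ (τ.shift 1)) (τ.shift 1)).erase := by
    intro Δ
    simp only [RType.erase, RType.erase_shift]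
    exact .cst (.fix _)
  refine ⟨ht _, fun θ _ => ?_⟩
  simp only [RType.subst, Term.subst, mem_den_fn, RType.subst_shift_upSub, RType.shift_inst]
  refine ⟨by simpa [RType.erase, RType.subst] using ht [], fun f hf => ?_⟩
  rw [RType.erase_shift] at hf
  refine fix_mem_den (by simpa using hτ) hf.1 fun n => ?_
  induction n with
  | zero => exact mem_den_of_noVal (by simpa using hτ) (hf.1.approx 0) (noVal_approx_zero f)
  | succ n ih => exact mem_den_of_steps (.single (approx_succ_step n f)) (hf.1.approx _) (hf.2 _ ih)

theorem Sub.erase_eq {Γ : Env S} {τ τ' : RType S} (h : Sub Γ τ τ') : τ.erase = τ'.erase := by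
  induction h with
  | base => rfl
  | fn _ _ ih₁ ih₂ => simp [RType.erase, ih₁, ih₂]

theorem Sub.den_subset {Γ : Env S} {τ τ' : RType S} (h : Sub Γ τ τ') {θ : List (Term S)}
    (hθ : θ ∈ Γ.den) : (τ.subst (subOf θ)).den ⊆ (τ'.subst (subOf θ)).den := by
  induction h generalizing θ with
  | base h => exact h θ hθ
  | fn h₁ h₂ ih₁ ih₂ =>
    intro e he
    simp only [RType.subst, mem_den_fn, RType.erase_subst] at he ⊢
    rw [h₁.erase_eq, ← h₂.erase_eq]
    refine ⟨he.1, fun a ha => ?_⟩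
    have h := he.2 a (ih₁ hθ ha)
    rw [RType.subst_upSub_inst] at h ⊢
    exact ih₂ (Env.den_ext hθ ha) h

theorem SemTy.sub {Γ : Env S} {p : Term S} {τ τ' : RType S} (h : SemTy Γ p τ') (hs : Sub Γ τ' τ) :
    SemTy Γ p τ :=
  ⟨hs.erase_eq ▸ h.1, fun θ hθ => hs.den_subset hθ (h.2 θ hθ)⟩

theorem SemTy.exact {Γ : Env S} {e r : Term S} {b : Base S.T} {l : Label}
    (h : SemTy Γ e (.base b l r)) : SemTy Γ e (.base b l (conj r (tEq b (.var 0) (e.shift 1)))) :=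
  ⟨h.1, fun θ hθ => (Reflects.base b l r e).subst _ |>.mem (h.2 θ hθ) fun _ _ _ _ _ hs => hs⟩

theorem SemTy.lam {Γ : Env S} {e : Term S} {τ₁ τ₂ : RType S} (h : SemTy (Γ.ext τ₁) e τ₂) :
    SemTy Γ (.lam e) (.fn τ₁ τ₂) := by
  have ht : STyped Γ.erase (.lam e) (RType.fn τ₁ τ₂).erase := .lam (by simpa using h.1)
  refine ⟨ht, fun θ hθ => ?_⟩
  have ht' := Env.styped_subst hθ ht
  simp only [RType.subst, mem_den_fn, RType.erase_subst]
  refine ⟨ht', fun a ha => ?_⟩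
  rw [RType.subst_upSub_inst]
  have h' := h.2 _ (Env.den_ext hθ ha)
  rw [← Term.subst_upSub_inst] at h'
  refine mem_den_of_steps (.single (.beta _ _)) ?_ h'
  have ha := styped_of_mem_den ha
  rw [RType.erase_subst] at ha ⊢
  exact .app ht' ha

theorem SemTy.app {Γ : Env S} {e₁ e₂ : Term S} {τ₁ τ₂ : RType S} (h₁ : SemTy Γ e₁ (.fn τ₁ τ₂))
    (h₂ : SemTy Γ e₂ τ₁) : SemTy Γ (.app e₁ e₂) (τ₂.inst e₂) := by
  refine ⟨by simpa using STyped.app h₁.1 h₂.1, fun θ hθ => ?_⟩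
  have h := (mem_den_fn.1 (h₁.2 θ hθ)).2 _ (h₂.2 θ hθ)
  rwa [RType.subst_upSub_inst, ← RType.inst_subst] at h

theorem SemTy.caseB {Γ : Env S} {e e₁ e₂ r : Term S} {l : Label} {τ : RType S}
    (h : SemTy Γ e (.base .bool l r)) (hl : l = .tot ∨ τ.MayDiverge)
    (h₁ : SemTy (Γ.ext (.base .bool l (conj r (tEq .bool (.var 0) (tBool true))))) e₁ (τ.shift 1))
    (h₂ : SemTy (Γ.ext (.base .bool l (conj r (tEq .bool (.var 0) (tBool false))))) e₂ (τ.shift 1)) :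
    SemTy Γ (.caseB e e₁ e₂) τ := by
  have ht : STyped Γ.erase (.caseB e e₁ e₂) τ.erase := by
    refine .caseB h.1 ?_ ?_
    · simpa [RType.erase] using h₁.1
    · simpa [RType.erase] using h₂.1
  refine ⟨ht, fun θ hθ => ?_⟩
  have ht' := Env.styped_subst hθ ht
  have he := h.2 θ hθ
  by_cases hv : Terminates (e.subst (subOf θ))
  · obtain ⟨w, hw, hs⟩ := hv
    obtain ⟨b, rfl⟩ := hw.eq_tBool (he.1.steps hs)
    have hx : tBool b ∈ ((RType.base .bool l
        (conj r (tEq .bool (.var 0) (tBool b)))).subst (subOf θ)).den := by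
      have hb := mem_den_base.1 (mem_den_base_of_steps he hs)
      refine mem_den_base.2 ⟨hb.1, fun w hw hs => .conj (hb.2.1 w hw hs) ?_, hb.2.2⟩
      exact Steps.tEq hw .refl hs
    refine mem_den_of_steps (hs.caseB_scrut _ _) (by simpa using ht') ?_
    have ht₀ : STyped [] (Term.caseB (tBool b) (e₁.subst (upSub (subOf θ)))
        (e₂.subst (upSub (subOf θ)))) (τ.subst (subOf θ)).erase := by
      simpa using ht'.steps (hs.caseB_scrut _ _)
    cases b with
    | true =>
      refine mem_den_of_steps (.single (.caseTrue _ _)) ht₀ ?_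
      rw [Term.subst_upSub_inst, ← RType.shift_subst_cons τ (tBool true)]
      exact h₁.2 _ (Env.den_ext hθ hx)
    | false =>
      refine mem_den_of_steps (.single (.caseFalse _ _)) ht₀ ?_
      rw [Term.subst_upSub_inst, ← RType.shift_subst_cons τ (tBool false)]
      exact h₂.2 _ (Env.den_ext hθ hx)
  · have hτ : τ.MayDiverge := hl.resolve_left fun hl => hv ((mem_den_base.1 he).2.2 hl)
    exact mem_den_of_noVal (by simpa using hτ) (by simpa using ht')
      (noVal_caseB _ _ fun w hw hs => hv ⟨w, hw, hs⟩)

theorem upSub_iterate_subst_subOf (as θ : List (Term S)) :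
    (fun n => (upSub^[as.length] (subOf θ) n).subst (subOf as)) = subOf (as ++ θ) := by
  funext n
  by_cases hn : n < as.length
  · rw [iterate_upSub_lt _ hn, subOf_append_left _ _ _ hn]
    have := subOf_append_left as [] n hn
    rwa [List.append_nil] at this
  · obtain ⟨m, rfl⟩ : ∃ m, n = m + as.length := ⟨n - as.length, by omega⟩
    rw [iterate_upSub_add, subOf_append]
    have := Term.shift_subst_append (subOf θ m) as [] rfl
    rwa [List.append_nil, subOf_nil, Term.subst_var] at this

theorem map_range_vars (es θ : List (Term S)) (c : Term S) :
    ((List.range es.length).map (fun j => Term.var (j + 2))).map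
      (·.subst (upSub (subOf (c :: (es ++ θ))))) = es.map (Term.shift 1) := by
  apply List.ext_getElem
  · simp
  · intro j h₁ h₂
    simp only [List.length_map] at h₂
    simp [Term.subst, upSub, subOf_append_left _ _ _ h₂]

theorem SemTy.caseD {Γ : Env S} {t : S.T} {e r : Term S} {br : Fin (S.ncon t) → Term S} {l : Label}
    {τ : RType S} (h : SemTy Γ e (.base (.data t) l r)) (hl : l = .tot ∨ τ.MayDiverge)
    (h' : ∀ i, SemTy
      (.base (.data t) l
          (conj (r.rename (upRen (· + (arity t i + 1))))
            (tEq (.data t) (.var 0) (Term.apps (.cst (.con t i))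
              ((List.range (arity t i)).map (fun j => .var (j + 2)))))) ::
        ((S.fields t i).map (fun b => triv b l) ++ Γ))
      (br i) (τ.shift (arity t i + 1))) :
    SemTy Γ (.caseD t e br) τ := by
  have ht : STyped Γ.erase (.caseD t e br) τ.erase := by
    refine .caseD h.1 fun i => ?_
    simpa [Env.erase, RType.erase, triv, Function.comp_def] using (h' i).1
  refine ⟨ht, fun θ hθ => ?_⟩
  have ht' := Env.styped_subst hθ ht
  have he := h.2 θ hθ
  by_cases hc : ∃ c, IsCon t c ∧ Steps (e.subst (subOf θ)) c
  · obtain ⟨c, hc, hs⟩ := hc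
    obtain ⟨c', ⟨i, es, hes, rfl⟩, hs, hs'⟩ :=
      hs.caseD_scrut (fun i => (br i).subst (upSub^[arity t i + 1] (subOf θ))) hc
    have hs'' := hs'.tail (.caseD _ hes)
    refine mem_den_of_steps hs'' (by simpa using ht') ?_
    have hce := mem_den_base_of_steps he hs
    generalize hceq : Term.apps (.cst (.con t i)) es = c' at *
    have hsub := upSub_iterate_subst_subOf (c' :: es) θ
    rw [List.length_cons, hes] at hsub
    rw [Term.subst_subst, hsub, ← RType.shift_subst_append τ (c' :: es) θ (k := arity t i + 1)
      (by simp [hes])]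
    have hfields : List.Forall₂ (fun e b => e ∈ (triv b l : RType S).den) es (S.fields t i) := by
      have h₁ := hce.1
      rw [← hceq] at h₁
      have h₂ := h₁.con_apps_base.2
      rw [List.forall₂_map_right_iff] at h₂
      refine List.forall₂_iff_get.2 ⟨h₂.length_eq, fun j hj hj' => mem_den_triv.2
        ⟨(List.forall₂_iff_get.1 h₂).2 j hj hj', fun hl => ?_⟩⟩
      obtain ⟨w, hw, hsw⟩ := hce.2.2 hl
      rw [← hceq] at hsw
      obtain ⟨ws, rfl, hws⟩ := hsw.con_apps_inv hw
      exact ⟨_, (List.forall₂_iff_get.1 hws).2 j hj (by rw [← hws.length_eq]; exact hj)⟩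
    refine (h' i).2 _ (Env.den_cons (Env.den_triv_append hθ hfields) ?_)
    have hce := mem_den_base.1 hce
    refine mem_den_base.2 ⟨hce.1, fun w hw hsw => ?_, hce.2.2⟩
    refine Steps.conj (r := Term.inst _ w) (s := Term.inst _ w) ?_ ?_
    · have := hce.2.1 w hw hsw
      have hr : (r.rename (upRen (· + (arity t i + 1)))).subst (upSub (subOf (c' :: (es ++ θ)))) =
          r.subst (upSub (subOf θ)) := by
        rw [Term.subst_rename, upSub_upRen]
        congr 2; funext n
        have := subOf_append (c' :: es) θ n
        rwa [List.length_cons, hes] at this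
      exact (congrArg (fun r => Steps (Term.inst r w) (tBool true)) hr).mpr this
    · have hr : (tEq (.data t) (.var 0) (Term.apps (.cst (.con t i))
          ((List.range (arity t i)).map (fun j => .var (j + 2))))).subst
            (upSub (subOf (c' :: (es ++ θ)))) = tEq (.data t) (.var 0) (c'.shift 1) := by
        have hshift : c'.shift 1 = Term.apps (.cst (.con t i)) (es.map (Term.shift 1)) := by
          rw [← hceq, Term.shift, Term.rename_eq_subst, Term.subst_apps]
          congr 2; funext e
          exact (Term.rename_eq_subst e _).symm
        rw [hshift, ← map_range_vars es θ c', hes]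
        exact congrArg (tEq (.data t) (.var 0)) (Term.subst_apps _ _ _)
      refine (congrArg (fun r => Steps (Term.inst r w) (tBool true)) hr).mpr ?_
      rw [tEq_var_inst]
      exact Steps.tEq hw .refl hsw
  · have hτ : τ.MayDiverge := hl.resolve_left fun hl => by
      obtain ⟨w, hw, hs⟩ := he.2.2 hl
      exact hc ⟨w, hw.isCon (he.1.steps hs), hs⟩
    exact mem_den_of_noVal (by simpa using hτ) (by simpa using ht')
      (noVal_caseD _ fun c h hs => hc ⟨c, h, hs⟩)

theorem SemTy.letE {Γ : Env S} {τx τx' τ : RType S} {b₁ b₂ : Term S} (h₁ : SemDef Γ τx' b₁)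
    (hτ : τx' = τx.shift 1 ∨ Reflects (τx.shift 1) b₁ τx')
    (h₂ : SemTy (τx' :: Γ) b₂ (τ.shift 1)) : SemTy Γ (.letE τx b₁ b₂) τ := by
  have herase : τx'.erase = τx.erase := by
    rcases hτ with rfl | h
    · simp
    · simpa using h.erase_eq
  have ht : STyped Γ.erase (.letE τx b₁ b₂) τ.erase := by
    refine .letE (herase ▸ h₁.1) ?_
    simpa [Env.erase, herase] using h₂.1
  refine ⟨ht, fun θ hθ => ?_⟩
  have h := h₂.2 _ (Env.den_cons hθ (h₁.2 τx hτ θ hθ))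
  rw [RType.shift_subst_cons, ← Term.subst_upSub_inst] at h
  exact mem_den_of_steps (.single (.letE _ _ _)) (by simpa using Env.styped_subst hθ ht) h

theorem SemTy.reflect {Γ : Env S} {τf τf' τ : RType S} {e p : Term S}
    (hτ : Reflects (τf.shift 1) e τf') (h₁ : SemDef Γ τf' e)
    (h₂ : SemTy (τf' :: Γ) p (τ.shift 1)) : SemTy Γ (.reflect τf e p) τ := by
  have h := SemTy.letE h₁ (.inr hτ) h₂
  have ht : STyped Γ.erase (.reflect τf e p) τ.erase := by
    cases h.1 with | letE h₁ h₂ => exact .reflect h₁ h₂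
  exact ⟨ht, fun θ hθ => mem_den_of_steps (.single (.reflect _ _ _))
    (by simpa using Env.styped_subst hθ ht) (h.2 θ hθ)⟩

/-! ### Definitions -/

theorem steps_tFix (b : Term S) : Steps (tFix b) (b.inst (tFix b)) :=
  .head (.fix _) (.single (.beta _ _))

theorem STyped.tFix {Δ : List (STy S)} {b : Term S} {σ : STy S} (h : STyped (σ :: Δ) b σ) :
    STyped Δ (tFix b) σ :=
  .app (.cst (.fix σ)) (.lam h)

theorem SemDef.nonRec {Γ : Env S} {τ : RType S} {b : Term S} (h : SemTy Γ b τ) :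
    SemDef Γ (τ.shift 1) (b.shift 1) := by
  have ht : STyped ((τ.shift 1).erase :: Γ.erase) (b.shift 1) (τ.shift 1).erase := by
    simpa using h.1.shift τ.erase
  refine ⟨ht, fun τ₀ _ θ hθ => ?_⟩
  have ht' := Env.styped_subst hθ ht.tFix
  rw [RType.shift_subst_cons]
  refine mem_den_of_steps (steps_tFix _) (by simpa using ht') ?_
  rw [Term.subst_upSub_inst, Term.shift_subst_cons]
  exact h.2 θ hθ

theorem SemDef.div {Γ : Env S} {τ : RType S} {b : Term S} (hτ : τ.MayDiverge)
    (h : SemTy (τ :: Γ) b τ) : SemDef Γ τ b := by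
  refine ⟨h.1, fun τ₀ h₀ θ hθ => ?_⟩
  set T := τ₀.subst (subOf θ) with hT
  set B := b.subst (upSub (subOf θ)) with hB
  have hrel : ∀ g, τ.subst (subOf (g :: θ)) = T ∨
      Reflects T (B.inst g) (τ.subst (subOf (g :: θ))) := by
    intro g
    rw [hB, Term.subst_upSub_inst, hT, ← RType.shift_subst_cons τ₀ g θ]
    rcases h₀ with rfl | h₀
    · exact .inl rfl
    · exact .inr (h₀.subst _)
  have hdiv : T.MayDiverge := by
    rcases h₀ with rfl | h₀
    · simpa [hT] using hτ
    · simpa [hT, h₀.mayDiverge_iff] using hτ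
  have herase : T.erase = τ.erase := by
    rcases h₀ with rfl | h₀
    · simp [hT]
    · simp [hT, h₀.erase_eq]
  have hrefine : ∀ {f g : Term S}, f ∈ T.den → ObsLe f (B.inst g) →
      f ∈ (τ.subst (subOf (g :: θ))).den := by
    intro f g hf hfg
    rcases hrel g with h | h
    · rwa [h]
    · exact h.mem hf hfg
  have hforget : ∀ {f g : Term S}, f ∈ (τ.subst (subOf (g :: θ))).den → f ∈ T.den := by
    intro f g hf
    rcases hrel g with h | h
    · rwa [h] at hf
    · exact h.mem_of_mem hf
  have htF : STyped [] (tFix B) T.erase := by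
    rw [herase]
    exact Env.styped_subst hθ (STyped.tFix h.1)
  have htB : STyped [] (.lam B) (.fn T.erase T.erase) := by
    rw [herase]
    exact Env.styped_subst hθ (STyped.lam h.1)
  have happrox : ∀ n, approx n (.lam B) ∈ T.den := by
    intro n
    induction n with
    | zero => exact mem_den_of_noVal hdiv (htB.approx 0) (noVal_approx_zero _)
    | succ n ih =>
      have hobs : ObsLe (approx n (.lam B)) (B.inst (approx n (.lam B))) := by
        intro as β w ht hw hs
        cases n with
        | zero =>
          have : ∀ e : Term S, NoVal e → NoVal (Term.apps e as) := by
            clear ht hs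
            induction as with
            | nil => exact fun e he => he
            | cons a as ih => exact fun e he => ih _ (he.app a)
          exact absurd hs (this _ (noVal_approx_zero _) w hw)
        | succ n =>
          have h₁ : Steps (approx (n + 1) (.lam B)) (B.inst (approx n (.lam B))) :=
            .head (approx_succ_step n _) (.single (.beta _ _))
          exact Steps.approx_mono (Nat.le_succ n) (ht.steps (h₁.apps as))
            ((h₁.apps as).of_steps_value hs hw) hw
      have h₁ := h.2 _ (Env.den_cons hθ (hrefine ih hobs))
      rw [← Term.subst_upSub_inst] at h₁
      exact mem_den_of_steps (.head (approx_succ_step n _) (.single (.beta _ _)))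
        (htB.approx _) (hforget h₁)
  exact hrefine (fix_mem_den hdiv htB happrox)
    fun as β w _ hw hs => Steps.of_steps_value ((steps_tFix B).apps as) hs hw

/-! ## Constants -/

/-- `x₁ : b₁^l → ⋯ → xₖ : bₖ^l → {v : b^l | v = C x₁ ⋯ xₖ}`. -/
def exactTy (l : Label) (bs : List (Base S.T)) (b : Base S.T) (C : Term S) : RType S :=
  arrowsL l bs (.base b l
    (tEq b (.var 0) (Term.apps (C.shift (bs.length + 1)) (recentVars bs.length 1))))

theorem arrowsL_subst (l : Label) (bs : List (Base S.T)) (τ : RType S) (s : ℕ → Term S) :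
    (arrowsL l bs τ).subst s = arrowsL l bs (τ.subst (upSub^[bs.length] s)) := by
  induction bs generalizing s with
  | nil => rfl
  | cons b bs ih => exact congrArg (RType.fn (triv b l)) (ih _)

theorem arrowsL_erase (l : Label) (bs : List (Base S.T)) (τ : RType S) :
    (arrowsL l bs τ).erase = STy.arrows (bs.map .base) τ.erase := by
  induction bs with
  | nil => rfl
  | cons b bs ih => exact congrArg (STy.fn (.base b)) ih

theorem exactTy_erase (l : Label) (bs : List (Base S.T)) (b : Base S.T) (C : Term S) :
    (exactTy l bs b C).erase = STy.arrows (bs.map .base) (.base b) :=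
  arrowsL_erase _ _ _

theorem tEq_var_subst (b : Base S.T) (e : Term S) (n : ℕ) (s : ℕ → Term S) :
    (tEq b (.var 0) e).subst (upSub^[n + 1] s) = tEq b (.var 0) (e.subst (upSub^[n + 1] s)) := by
  simp only [tEq, Term.subst, iterate_upSub_lt s (Nat.succ_pos n)]

theorem exactTy_inst (l : Label) (b' : Base S.T) (bs : List (Base S.T)) (b : Base S.T)
    (C a : Term S) : (arrowsL l bs (.base b l (tEq b (.var 0) (Term.apps
      (C.shift ((b' :: bs).length + 1)) (recentVars (b' :: bs).length 1))))).inst a =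
        exactTy l bs b (.app C a) := by
  rw [RType.inst, arrowsL_subst, exactTy, RType.subst]
  simp only [List.length_cons]
  rw [← Function.iterate_succ_apply' upSub, ← apps_recentVars_inst C a bs.length 1,
    tEq_var_subst]

theorem exactTy_cst_subst (l : Label) (bs : List (Base S.T)) (b : Base S.T) (c : Cst S)
    (s : ℕ → Term S) : (exactTy l bs b (.cst c)).subst s = exactTy l bs b (.cst c) := by
  rw [exactTy, arrowsL_subst, RType.subst, ← Function.iterate_succ_apply' upSub]
  rw [tEq_var_subst, Term.subst_apps, map_subst_recentVars _ _ _ fun i hi => iterate_upSub_lt _ (by omega)]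
  rfl

theorem mem_den_exactTy {l : Label} {bs : List (Base S.T)} {b : Base S.T} {C : Term S}
    (ht : STyped [] C (STy.arrows (bs.map .base) (.base b)))
    (hl : l = .tot → ∀ as, List.Forall₂ (fun a b => a ∈ (triv b .tot : RType S).den) as bs →
      Terminates (Term.apps C as)) : C ∈ (exactTy l bs b C).den := by
  induction bs generalizing C with
  | nil =>
    refine mem_den_base.2 ⟨ht, fun w hw hs => ?_, fun h => hl h [] .nil⟩
    change Steps ((tEq b (.var 0) (C.shift 1)).inst w) _
    rw [tEq_var_inst]
    exact Steps.tEq hw .refl hs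
  | cons b' bs ih =>
    refine mem_den_fn.2 ⟨?_, fun a ha => ?_⟩
    · have := exactTy_erase l (b' :: bs) b C
      change STyped [] C (exactTy l (b' :: bs) b C).erase
      rwa [this]
    · refine (exactTy_inst l b' bs b C a).symm ▸ ih (.app ht (styped_of_mem_den ha)) fun h as has =>
        hl h (a :: as) (.cons (h ▸ ha) has)

theorem terminates_of_mem_triv {b : Base S.T} {e : Term S} (h : e ∈ (triv b .tot : RType S).den) :
    ∃ w, Value w ∧ Steps e w ∧ STyped [] w (.base b) := by
  rw [mem_den_triv] at h
  obtain ⟨w, hw, hs⟩ := h.2 rfl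
  exact ⟨w, hw, hs, h.1.steps hs⟩

theorem terminates_bin (o : BinOp) {a b : Term S} (ha : a ∈ (triv o.dom .tot : RType S).den)
    (hb : b ∈ (triv o.dom .tot : RType S).den) : Terminates (tBin o a b) := by
  obtain ⟨v, hv, hsv, htv⟩ := terminates_of_mem_triv ha
  obtain ⟨w, hw, hsw, htw⟩ := terminates_of_mem_triv hb
  suffices H : ∃ c₁ c₂ c : Cst S, v = .cst c₁ ∧ w = .cst c₂ ∧ BinOp.eval o c₁ c₂ = some c by
    obtain ⟨c₁, c₂, c, rfl, rfl, hc⟩ := H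
    exact ⟨_, .cst c, Steps.tBin hsv hsw hc⟩
  cases o with
  | and | or =>
    obtain ⟨m, rfl⟩ := hv.eq_tBool htv
    obtain ⟨n, rfl⟩ := hw.eq_tBool htw
    exact ⟨_, _, _, rfl, rfl, rfl⟩
  | _ =>
    obtain ⟨m, rfl⟩ := hv.eq_tInt htv
    obtain ⟨n, rfl⟩ := hw.eq_tInt htw
    exact ⟨_, _, _, rfl, rfl, rfl⟩

theorem PrimTy.eq_exactTy {l : Label} {c : Cst S} {τ : RType S} (h : PrimTy l c τ) :
    ∃ l' bs b, τ = exactTy l' bs b (.cst c) ∧ CstTy c (STy.arrows (bs.map .base) (.base b)) ∧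
      ∀ as, List.Forall₂ (fun a b => a ∈ (triv b .tot : RType S).den) as bs →
        Terminates (Term.apps (.cst c) as) := by
  cases h with
  | int n =>
    refine ⟨.tot, [], .int, rfl, .int n, fun as has => ?_⟩
    cases has
    exact ⟨_, .cst _, .refl⟩
  | bool b =>
    refine ⟨.tot, [], .bool, rfl, .bool b, fun as has => ?_⟩
    cases has
    exact ⟨_, .cst _, .refl⟩
  | not =>
    refine ⟨l, [.bool], .bool, rfl, .not, fun as has => ?_⟩
    obtain ⟨a, _, ha, h, rfl⟩ := List.forall₂_cons_right_iff.1 has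
    cases h
    obtain ⟨w, hw, hs, ht⟩ := terminates_of_mem_triv ha
    obtain ⟨b, rfl⟩ := hw.eq_tBool ht
    exact ⟨_, value_tBool _, (Steps.primArg (c := .not) trivial hs).tail (.not b)⟩
  | bin o =>
    refine ⟨l, [o.dom, o.dom], o.cod, rfl, .bin o, fun as has => ?_⟩
    obtain ⟨a, _, ha, h, rfl⟩ := List.forall₂_cons_right_iff.1 has
    obtain ⟨b, as, hb, h', rfl⟩ := List.forall₂_cons_right_iff.1 h
    obtain rfl := List.forall₂_nil_right_iff.1 h'
    exact terminates_bin o ha hb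
  | eq b =>
    refine ⟨l, [b, b], .bool, rfl, .eq b, fun as has => ?_⟩
    obtain ⟨a, _, ha, h, rfl⟩ := List.forall₂_cons_right_iff.1 has
    obtain ⟨a', as, ha', h', rfl⟩ := List.forall₂_cons_right_iff.1 h
    obtain rfl := List.forall₂_nil_right_iff.1 h'
    obtain ⟨v, hv, hsv, -⟩ := terminates_of_mem_triv ha
    obtain ⟨w, hw, hsw, -⟩ := terminates_of_mem_triv ha'
    have hs := Steps.prim₂ (c := .eq (.base b)) trivial hsv hv hsw
    by_cases hvw : v = w
    · subst hvw
      exact ⟨_, value_tBool _, hs.tail (.eqTrue hv)⟩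
    · exact ⟨_, value_tBool _, hs.tail (.eqFalse hv hw hvw)⟩
  | size t =>
    refine ⟨l, [.data t], .int, rfl, .size t, fun as has => ?_⟩
    obtain ⟨a, _, ha, h, rfl⟩ := List.forall₂_cons_right_iff.1 has
    cases h
    obtain ⟨w, hw, hs, -⟩ := terminates_of_mem_triv ha
    exact ⟨_, value_tInt _, (Steps.primArg (c := .size t) trivial hs).tail (.size hw)⟩
  | con t i =>
    refine ⟨l, S.fields t i, .data t, rfl, .con t i, fun as has => ?_⟩
    have hl : as.length = arity t i := has.length_eq
    have : ∃ ws, List.Forall₂ (fun e w => Value w ∧ Steps e w) as ws := by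
      clear hl
      generalize S.fields t i = bs at has
      induction has with
      | nil => exact ⟨[], .nil⟩
      | cons h _ ih =>
        obtain ⟨w, hw, hs, -⟩ := terminates_of_mem_triv h
        obtain ⟨ws, hws⟩ := ih
        exact ⟨w :: ws, .cons ⟨hw, hs⟩ hws⟩
    obtain ⟨ws, hws⟩ := this
    refine ⟨_, .con t i ws (by rw [← hws.length_eq, hl]) fun w hw => ?_, Steps.con_apps hl.le hws⟩
    obtain ⟨j, hj, rfl⟩ := List.getElem_of_mem hw
    exact ((List.forall₂_iff_get.1 hws).2 j (by rw [hws.length_eq]; exact hj) hj).1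

theorem SemTy.cst {Γ : Env S} {l : Label} {c : Cst S} {τ : RType S} (h : PrimTy l c τ) :
    SemTy Γ (.cst c) τ := by
  obtain ⟨l', bs, b, rfl, ht, hterm⟩ := h.eq_exactTy
  refine ⟨?_, fun θ _ => ?_⟩
  · rw [exactTy_erase]
    exact .cst ht
  · rw [exactTy_cst_subst]
    exact mem_den_exactTy (.cst ht) fun _ => hterm

/-! ## Termination metrics -/

/-- The guard `0 ≤ X ∧ X < N`, or the guard `X = N`. -/
def metricGuard (lt : Bool) (N : ℤ) (X : Term S) : Term S :=
  if lt then conj (tBin .le (tInt 0) X) (tBin .lt X (tInt N)) else tEq .int X (tInt N)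

/-- The condition on the value of the metric that `metricGuard` expresses. -/
def metricCond (lt : Bool) (N j : ℤ) : Prop := if lt then 0 ≤ j ∧ j < N else j = N

/-- The metric `E`, applied to the `k + 1` most recent variables. -/
def metricVars (k : ℕ) (E : Term S) : Term S :=
  Term.apps (E.shift (k + 1)) (recentVars (k + 1) 0)

theorem metricGuard_subst (lt : Bool) (N : ℤ) (X : Term S) (s : ℕ → Term S) :
    (metricGuard lt N X).subst s = metricGuard lt N (X.subst s) := by
  cases lt <;> rfl

theorem metricVars_zero_inst (E w : Term S) : (metricVars 0 E).inst w = .app E w := by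
  have := apps_recentVars_inst E w 0 0
  rwa [Term.shift_zero] at this

theorem metricVars_subst (k : ℕ) (E a : Term S) :
    (metricVars (k + 1) E).subst (upSub^[k + 1] (subOf [a])) = metricVars k (.app E a) :=
  apps_recentVars_inst E a (k + 1) 0

theorem metricGuard_steps_iff {X : Term S} {j : ℤ} (hX : Steps X (tInt j)) (lt : Bool) (N : ℤ) :
    Steps (metricGuard lt N X) (tBool true) ↔ metricCond lt N j := by
  have key : ∀ {e : Term S} {p : Prop} [Decidable p], Steps e (tBool (decide p)) →
      (Steps e (tBool true) ↔ p) := by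
    intro e p _ h
    constructor
    · intro h'
      have := Steps.value_unique h (value_tBool _) h' (value_tBool _)
      simpa [tBool] using this
    · intro hp
      rwa [decide_eq_true hp] at h
  cases lt with
  | true =>
    have h₁ := key (Steps.tBin (o := .le) (c := .bool (decide (0 ≤ j))) (.refl (a := tInt 0)) hX rfl)
    have h₂ := key (Steps.tBin (o := .lt) (c := .bool (decide (j < N))) hX (.refl (a := tInt N)) rfl)
    simp only [metricGuard, metricCond, if_true]
    rw [← h₁, ← h₂]
    exact ⟨Steps.of_conj, fun h => h.1.conj h.2⟩
  | false =>
    simp only [metricGuard, metricCond, Bool.false_eq_true, if_false]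
    refine key (p := j = N) ?_
    have h := Steps.prim₂ (c := .eq (.base .int)) trivial hX (value_tInt j) (.refl (a := tInt N))
    by_cases hj : j = N
    · subst hj
      rw [decide_eq_true rfl]
      exact h.tail (.eqTrue (value_tInt j))
    · rw [decide_eq_false hj]
      exact h.tail (.eqFalse (value_tInt j) (value_tInt N) (by simpa [tInt] using hj))

theorem Guard.subst {k : ℕ} {g : Term S} {τ τ' : RType S} (h : Guard k g τ τ') (s : ℕ → Term S) :
    Guard k (g.subst (upSub^[k + 1] s)) (τ.subst s) (τ'.subst s) := by
  induction h generalizing s with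
  | zero g b r τ => exact .zero _ _ _ _
  | succ _ ih => exact .succ (ih _)

theorem Guard.erase_eq {k : ℕ} {g : Term S} {τ τ' : RType S} (h : Guard k g τ τ') :
    τ'.erase = τ.erase := by
  induction h with
  | zero => rfl
  | succ _ ih => simp [RType.erase, ih]

theorem MetricTy.subst {k : ℕ} {τ μ : RType S} (h : MetricTy k τ μ) (s : ℕ → Term S) :
    MetricTy k (τ.subst s) (μ.subst s) := by
  induction h generalizing s with
  | zero τ₁ τ₂ => exact .zero _ _
  | succ _ ih => exact .succ (ih _)

theorem Guard.inst {k : ℕ} {lt : Bool} {N : ℤ} {E : Term S} {τ τ' : RType S}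
    (h : Guard k (metricGuard lt N (metricVars (k + 1) E)) τ τ') (a : Term S) :
    Guard k (metricGuard lt N (metricVars k (.app E a))) (τ.inst a) (τ'.inst a) := by
  have h' := h.subst (subOf [a])
  rwa [metricGuard_subst, metricVars_subst] at h'

/-- A function that belongs to guarded types whose guards cover the arguments of another type, guarded
or not, belongs to the latter. -/
theorem mem_den_of_guards {k : ℕ} {τ μ τ' : RType S} {E F : Term S} {P : ℤ → Prop}
    (hμ : MetricTy k τ μ) (hE : E ∈ μ.den) (hF : STyped [] F τ.erase)
    (hτ' : (τ' = τ ∧ ∀ j, P j) ∨ ∃ lt N, (∀ j, metricCond lt N j → P j) ∧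
      Guard k (metricGuard lt N (metricVars k E)) τ τ')
    (hcover : ∀ j, P j → ∃ lt N τ'', metricCond lt N j ∧
      Guard k (metricGuard lt N (metricVars k E)) τ τ'' ∧ F ∈ τ''.den) : F ∈ τ'.den := by
  induction k generalizing τ μ τ' E F with
  | zero =>
    cases hμ with
    | zero τ₁ τ₂ =>
    have hdom : ∃ b r, τ₁ = .base b .tot r := by
      rcases hτ' with ⟨-, hP⟩ | ⟨_, _, -, hg⟩
      · obtain ⟨_, _, _, -, hg, -⟩ := hcover 0 (hP 0)
        cases hg
        exact ⟨_, _, rfl⟩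
      · cases hg
        exact ⟨_, _, rfl⟩
    obtain ⟨b, r, rfl⟩ := hdom
    have hmetric : ∀ a ∈ (RType.base b .tot r).den, ∃ w j, Value w ∧ Steps a w ∧
        ∀ lt N, Steps ((metricGuard lt N (metricVars 0 E)).inst w) (tBool true) ↔
          metricCond lt N j := by
      intro a ha
      obtain ⟨w, hw, hs⟩ := (mem_den_base.1 ha).2.2 rfl
      have h := (mem_den_fn.1 hE).2 w (mem_den_base_of_steps ha hs)
      obtain ⟨v, hv, hsv, htv⟩ := terminates_of_mem_triv (b := .int) h
      obtain ⟨j, rfl⟩ := hv.eq_tInt htv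
      refine ⟨w, j, hw, hs, fun lt N => ?_⟩
      rw [Term.inst, metricGuard_subst]
      change Steps (metricGuard lt N ((metricVars 0 E).inst w)) _ ↔ _
      rw [metricVars_zero_inst]
      exact metricGuard_steps_iff hsv lt N
    have hfinish : ∀ a ∈ (RType.base b .tot r).den, ∀ w j, Value w → Steps a w →
        (∀ lt N, Steps ((metricGuard lt N (metricVars 0 E)).inst w) (tBool true) ↔
          metricCond lt N j) → P j → .app F a ∈ (τ₂.inst a).den := by
      intro a ha w j hw hs hiff hj
      obtain ⟨lt, N, τ'', hc, hg, hF'⟩ := hcover j hj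
      cases hg
      refine (mem_den_fn.1 hF').2 a ?_
      have ha := mem_den_base.1 ha
      refine mem_den_base.2 ⟨ha.1, fun w' hw' hs' => .conj (ha.2.1 w' hw' hs') ?_, ha.2.2⟩
      obtain rfl := Steps.value_unique hs hw hs' hw'
      exact (hiff lt N).2 hc
    rcases hτ' with ⟨rfl, hP⟩ | ⟨lt, N, hP, hg⟩
    · refine mem_den_fn.2 ⟨hF, fun a ha => ?_⟩
      obtain ⟨w, j, hw, hs, hiff⟩ := hmetric a ha
      exact hfinish a ha w j hw hs hiff (hP j)
    · cases hg
      refine mem_den_fn.2 ⟨hF, fun a ha => ?_⟩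
      have ha' := mem_den_base.1 ha
      have ha₀ : a ∈ (RType.base b .tot r).den :=
        mem_den_base.2 ⟨ha'.1, fun w hw hs => (Steps.of_conj (ha'.2.1 w hw hs)).1, ha'.2.2⟩
      obtain ⟨w, j, hw, hs, hiff⟩ := hmetric a ha₀
      exact hfinish a ha₀ w j hw hs hiff
        (hP j ((hiff lt N).1 (Steps.of_conj (ha'.2.1 w hw hs)).2))
  | succ k ih =>
    cases hμ with
    | @succ _ τ₁ τ₂ μ hμ =>
    have hτ₂ : ∃ τ₂', τ' = .fn τ₁ τ₂' ∧ τ₂'.erase = τ₂.erase ∧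
        ∀ a, (τ₂'.inst a = τ₂.inst a ∧ ∀ j, P j) ∨ ∃ lt N, (∀ j, metricCond lt N j → P j) ∧
          Guard k (metricGuard lt N (metricVars k (.app E a))) (τ₂.inst a) (τ₂'.inst a) := by
      rcases hτ' with ⟨rfl, hP⟩ | ⟨lt, N, hP, hg⟩
      · exact ⟨τ₂, rfl, rfl, fun a => .inl ⟨rfl, hP⟩⟩
      · cases hg with
        | succ hg => exact ⟨_, rfl, hg.erase_eq, fun a => .inr ⟨lt, N, hP, hg.inst a⟩⟩
    obtain ⟨τ₂', rfl, he, hτ₂⟩ := hτ₂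
    refine mem_den_fn.2 ⟨he ▸ hF, fun a ha => ih (hμ.subst (subOf [a]))
      ((mem_den_fn.1 hE).2 a ha) ?_ (hτ₂ a) fun j hj => ?_⟩
    · rw [RType.erase_subst]
      exact .app hF (styped_of_mem_den ha)
    · obtain ⟨lt, N, τ'', hc, hg, hF'⟩ := hcover j hj
      cases hg with
      | succ hg => exact ⟨lt, N, _, hc, hg.inst a, (mem_den_fn.1 hF').2 a ha⟩

theorem metricAt_subst (k : ℕ) (e F : Term S) (N : ℤ) (θ : List (Term S)) :
    (metricAt k e).subst (upSub^[k + 1] (subOf (F :: tInt N :: θ))) =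
      metricVars k (e.subst (subOf θ)) := by
  rw [metricAt, metricVars, Term.subst_apps,
    map_subst_recentVars _ _ _ fun i hi => iterate_upSub_lt _ (by omega)]
  rw [show k + 3 = 2 + (k + 1) by omega, ← Term.shift_shift, Term.subst_shift_iterate]
  exact congrArg (fun E => Term.apps (E.shift (k + 1)) _)
    (Term.shift_subst_append (k := 2) e [F, tInt N] θ rfl)

theorem metricVar_subst (k : ℕ) (F : Term S) (N : ℤ) (θ : List (Term S)) :
    upSub^[k + 1] (subOf (F :: tInt N :: θ)) (k + 2) = tInt N := by
  rw [show k + 2 = 1 + (k + 1) by omega, iterate_upSub_add]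
  rfl

theorem metricLt_subst (k : ℕ) (e F : Term S) (N : ℤ) (θ : List (Term S)) :
    (metricLt k e).subst (upSub^[k + 1] (subOf (F :: tInt N :: θ))) =
      metricGuard true N (metricVars k (e.subst (subOf θ))) := by
  simp only [metricLt, conj, tBin, Term.subst, metricAt_subst, metricVar_subst, metricGuard, if_true]
  rfl

theorem metricEq_subst (k : ℕ) (e F : Term S) (N : ℤ) (θ : List (Term S)) :
    (metricEq k e).subst (upSub^[k + 1] (subOf (F :: tInt N :: θ))) =
      metricGuard false N (metricVars k (e.subst (subOf θ))) := by
  simp only [metricEq, tEq, Term.subst, metricAt_subst, metricVar_subst, metricGuard,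
    Bool.false_eq_true, if_false]

theorem subOf_skip (F n : Term S) (θ : List (Term S)) :
    (fun i => subOf (F :: n :: θ) (upRen (· + 1) i)) = subOf (F :: θ) := by
  funext i; cases i <;> simp [upRen]

theorem SemDef.metric {Γ : Env S} {τ μ τlt τeq : RType S} {b e : Term S} {k : ℕ}
    (hμ : MetricTy k τ (μ.shift 1)) (he : SemTy Γ e μ)
    (hlt : Guard k (metricLt k e) (τ.rename (upRen (· + 1))) τlt)
    (heq : Guard k (metricEq k e) (τ.rename (upRen (· + 1))) τeq)
    (hb : SemTy (τlt :: triv .int .tot :: Γ) (b.rename (upRen (· + 1))) τeq) : SemDef Γ τ b := by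
  have hlte : τlt.erase = τ.erase := by simpa using hlt.erase_eq
  have heqe : τeq.erase = τ.erase := by simpa using heq.erase_eq
  have ht : STyped (τ.erase :: Γ.erase) b τ.erase := by
    have h := hb.1
    rw [heqe] at h
    have h' := h.subst (Δ' := τ.erase :: Γ.erase)
      (s := fun i => match i with | 0 => .var 0 | 1 => tInt 0 | i + 2 => .var (i + 1)) (by
        intro i σ hi
        match i with
        | 0 => exact .var (by simpa [Env.erase, hlte] using hi)
        | 1 =>
          obtain rfl : STy.base .int = σ := by simpa [Env.erase, triv, RType.erase] using hi
          exact .cst (.int 0)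
        | i + 2 => exact .var (by simpa [Env.erase] using hi))
    rw [Term.subst_rename] at h'
    convert h'
    conv_lhs => rw [← Term.subst_var b]
    congr 1; funext i; cases i <;> rfl
  refine ⟨ht, fun _ _ θ hθ => ?_⟩
  have htF := Env.styped_subst hθ ht.tFix
  set F := (tFix b).subst (subOf θ) with hFdef
  set T := τ.subst (subOf (F :: θ)) with hT
  have hTe : T.erase = τ.erase := by simp [hT]
  have hskip : ∀ N, (τ.rename (upRen (· + 1))).subst (subOf (F :: tInt N :: θ)) = T := by
    intro N
    rw [RType.subst_rename, subOf_skip]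
  have hM : MetricTy k T (μ.subst (subOf θ)) := by
    have h := hμ.subst (subOf (F :: θ))
    rwa [RType.shift_subst_cons] at h
  have hE := he.2 θ hθ
  have hglt : ∀ N, Guard k (metricGuard true N (metricVars k (e.subst (subOf θ)))) T
      (τlt.subst (subOf (F :: tInt N :: θ))) := by
    intro N
    have h := hlt.subst (subOf (F :: tInt N :: θ))
    rwa [metricLt_subst, hskip] at h
  have hgeq : ∀ N, Guard k (metricGuard false N (metricVars k (e.subst (subOf θ)))) T
      (τeq.subst (subOf (F :: tInt N :: θ))) := by
    intro N
    have h := heq.subst (subOf (F :: tInt N :: θ))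
    rwa [metricEq_subst, hskip] at h
  have hstep : ∀ N, F ∈ (τlt.subst (subOf (F :: tInt N :: θ))).den →
      F ∈ (τeq.subst (subOf (F :: tInt N :: θ))).den := by
    intro N hN
    have hint : tInt N ∈ ((triv .int .tot : RType S).subst (subOf (tInt N :: θ))).den :=
      mem_den_triv.2 ⟨.cst (.int N), fun _ => ⟨_, value_tInt N, .refl⟩⟩
    have h := hb.2 _ (Env.den_cons (Env.den_cons hθ hint) hN)
    rw [Term.subst_rename, subOf_skip, ← Term.subst_upSub_inst] at h
    exact mem_den_of_steps (steps_tFix _) (by rw [RType.erase_subst, heqe]; exact htF) h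
  have hltmem : ∀ (n : ℕ) (N : ℤ), N ≤ n → F ∈ (τlt.subst (subOf (F :: tInt N :: θ))).den := by
    intro n
    induction n with
    | zero =>
      intro N hN
      refine mem_den_of_guards (P := fun _ => False) hM hE (hTe ▸ htF)
        (.inr ⟨true, N, fun j hj => ?_, hglt N⟩) fun j hj => hj.elim
      simp only [metricCond, if_true] at hj
      push_cast at hN
      omega
    | succ n ih =>
      intro N hN
      refine mem_den_of_guards (P := fun j => j < N) hM hE (hTe ▸ htF)
        (.inr ⟨true, N, fun j hj => ?_, hglt N⟩) fun j hj =>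
          ⟨false, j, _, by simp [metricCond], hgeq j, hstep j (ih j (by push_cast at hN; omega))⟩
      simp only [metricCond, if_true] at hj
      exact hj.2
  exact mem_den_of_guards (P := fun _ => True) hM hE (hTe ▸ htF) (.inl ⟨rfl, fun _ => trivial⟩)
    fun j _ => ⟨false, j, _, by simp [metricCond], hgeq j,
      hstep j (hltmem j.toNat j (Int.self_le_toNat j))⟩

/-! ## Soundness -/

mutual

theorem HasType.sem {m : Mode} {Γ : Env S} {p : Term S} {τ : RType S} :
    HasType m Γ p τ → m = .source → SemTy Γ p τ
  | .var h, _ => .var h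
  | .cst h, _ => .cst h
  | .eqFun _ _, hm => nomatch hm
  | .fix h, _ => .fix h
  | .sub h hs, hm => (h.sem hm).sub hs
  | .exact h, hm => (h.sem hm).exact
  | .lam h, hm => (h.sem hm).lam
  | .app h₁ h₂, hm => (h₁.sem hm).app (h₂.sem hm)
  | .caseD h hl _ h', hm => (h.sem hm).caseD hl fun i => (h' i).sem hm
  | .caseB h hl _ h₁ h₂, hm => (h.sem hm).caseB hl (h₁.sem hm) (h₂.sem hm)
  | .letE h₁ h₂ _, hm => SemTy.letE (h₁.sem hm) (.inl rfl) (h₂.sem hm)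
  | .reflect hr h₁ h₂ _, hm => SemTy.reflect hr (h₁.sem hm) (h₂.sem hm)

theorem DefOk.sem {m : Mode} {Γ : Env S} {τ : RType S} {b : Term S} :
    DefOk m Γ τ b → m = .source → SemDef Γ τ b
  | .div hτ h, hm => .div hτ (h.sem hm)
  | .metric hμ he hlt heq hb, hm => .metric hμ (he.sem hm) hlt heq (hb.sem hm)
  | .nonRec h, hm => .nonRec (h.sem hm)

end

end Refl

theorem mainTheorem1 (S : Refl.DataSig) (Γ : Refl.Env S) (p : Refl.Term S) (τ : Refl.RType S)
    (h : Refl.HasType Refl.Mode.source Γ p τ) :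
    ∀ θ ∈ Γ.den, p.subst (Refl.subOf θ) ∈ (τ.subst (Refl.subOf θ)).den :=
  (h.sem rfl).2
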